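/- **Setting.** A row player (maximizer) and a column player play an episodic repeated zero-sum game with $K$ episodes of $T$ rounds each, $KT\ge 2$, and action sets $[n_1],[n_2]$. At the beginning of episode $k$ expert games $M^{(k)}_1,\dots,M^{(k)}_S\in[0,1]^{n_1\times n_2}$ ($S\ge 1$, possibly random and depending on the past) are revealed. The true game is $M^{(k)}=\sum_{s=1}^S\theta^*_sM^{(k)}_s$ with an unknown $\theta^*\in\mathbb R^S$. At round $t$ of episode $k$ the players draw actions $i^{(k)}_t,j^{(k)}_t$, independently given the past, from mixed strategies $\mu^{(k)}$ and $\nu^{(k)}_t$ (the opponent's strategy $\nu^{(k)}_t$ is arbitrary), and observe $r^{(k)}_t=M^{(k)}_{i_t,j_t}+\eta^{(k)}_t$. Let $\mathcal H^{(k)}_{t-1}$ be the history before round $t$ of episode $k$: the actions and payoffs of all earlier rounds, and the expert games of episodes $1,\dots,k$. Given $\mathcal H^{(k)}_{t-1}$ and the actions $(i^{(k)}_t,j^{(k)}_t)$, the noise is centred and $1$-sub-Gaussian: $\mathbb E[\eta^{(k)}_t\mid\cdot]=0$ and $\mathbb E[e^{\gamma\eta^{(k)}_t}\mid\cdot]\le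 e^{\gamma^2/2}$ for all $\gamma\in\mathbb R$. (If $\theta^*$ is random, $\theta^*$ is added to all these conditionings, for the draws of the actions and for the noise, but it is not known to the row player.) Write $\operatorname{val}(M)=\sup_{\mu}\inf_{\nu}\mu^\top M\nu$ over mixed strategies, and $z^{(k)}_t=([M^{(k)}_s]_{i_t,j_t})_{s\le S}\in\mathbb R^S$. **Algorithm OFULinMat** with $B>0$, $\lambda>0$, $0<\delta<1$. Put $V_k=\lambda I+\sum_{k'\le k}\sum_{t}z^{(k')}_tz^{(k')\top}_t$, $Y_k=\sum_{k'\le k}\sum_t r^{(k')}_tz^{(k')}_t$, $\hat\theta^{(k)}=V_{k-1}^{-1}Y_{k-1}$, $\mathcal B=\{\theta:\|\theta\|_2^2\le B^2\}$ and $$\mathcal C_k=\{\theta:(\theta-\hat\theta^{(k)})^\top V_{k-1}(\theta-\hat\theta^{(k)})\le\beta_k\},\qquad \beta_k=\Bigl(\sqrt{2\ln\bigl(\det(V_{k-1})^{1/2}\det(\lambda I)^{-1/2}/\delta\bigr)}+\sqrt\lambda\,B\Bigr)^2 .$$ At the beginning of episode $k$ the row player chooses $\tilde\theta^{(k)}\in\arg\max_{\theta\in\mathcal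 C_k\cap\mathcal B}\operatorname{val}(\sum_s\theta_sM^{(k)}_s)$ and plays, in all rounds of the episode, a strategy $\mu^{(k)}\in\arg\max_\mu\min_\nu\mu^\top(\sum_s\tilde\theta^{(k)}_sM^{(k)}_s)\nu$, chosen as a measurable function of $\mathcal H^{(k)}_0$ (an arbitrary such strategy if $\mathcal C_k\cap\mathcal B=\emptyset$). **Statement.** For all $\lambda>0$, $B>0$, $\kappa>1$ there is a constant $C=C(\lambda,B,\kappa)$, not depending on $S,K,T,n_1,n_2$, the games, the noise or the opponent, such that the following holds. Assume that, with probability one, $\|\theta^*\|_2\le B$, and for $k=1,\dots,K$: $(\mu_1-\mu_2)^\top M^{(k)}\nu\le 1$ for all mixed strategies $\mu_1,\mu_2,\nu$, and $\det V_k\le\kappa\det V_{k-1}$. Then the saddle-point regret of OFULinMat run with $\delta=1/(KT)$ is well defined (its integrand is integrable) and $$\mathbb E\Bigl[\sum_{k=1}^K\sum_{t=1}^T\bigl(\operatorname{val}(M^{(k)})-r^{(k)}_t\bigr)\Bigr]\le C\,S\sqrt{KT}\,\ln(KTS).$$ In particular it is $\tilde O(S\sqrt{KT})$. -/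

import Mathlib

open MeasureTheory

universe u

noncomputable section

/-- The saddle-point value `sup_x inf_y xᵀ M y` of a zero-sum matrix game in mixed strategies
(row player maximizes, column player minimizes). -/
def gameValue {n₁ n₂ : ℕ} (M : Matrix (Fin n₁) (Fin n₂) ℝ) : ℝ :=
  ⨆ x : stdSimplex ℝ (Fin n₁), ⨅ y : stdSimplex ℝ (Fin n₂), x.1 ⬝ᵥ M.mulVec y.1

/-- `x` is a maximin (security) strategy of the row player in the game `M`:
`x ∈ argmax_{x'} min_y x'ᵀ M y`. -/
def IsMaximin {n₁ n₂ : ℕ} (M : Matrix (Fin n₁) (Fin n₂) ℝ) (x : Fin n₁ → ℝ) : Prop :=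
  x ∈ stdSimplex ℝ (Fin n₁) ∧
    ∀ x' ∈ stdSimplex ℝ (Fin n₁),
      (⨅ y : stdSimplex ℝ (Fin n₂), x' ⬝ᵥ M.mulVec y.1) ≤
        ⨅ y : stdSimplex ℝ (Fin n₂), x ⬝ᵥ M.mulVec y.1

/-- The linear combination `∑ s, θ_s M_s` of the expert games. -/
def mixGame {S n₁ n₂ : ℕ} (M : Fin S → Matrix (Fin n₁) (Fin n₂) ℝ) (θ : Fin S → ℝ) :
    Matrix (Fin n₁) (Fin n₂) ℝ :=
  ∑ s, θ s • M s

/-- The random quantities of an episodic repeated zero-sum game with `S` expert games, `K` episodes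
of `T` rounds each, and `n₁ × n₂` actions. Episodes and rounds are numbered from `0`.
The laws which these quantities obey are stated in `IsInteraction` and `IsOFULinMat`. -/
structure GameProcess (Ω : Type*) (S K T n₁ n₂ : ℕ) where
  /-- the true parameter `θ*` (a fixed vector is the special case of a constant function) -/
  param : Ω → Fin S → ℝ
  /-- the expert games revealed at the beginning of each episode -/
  expert : Fin K → Fin S → Ω → Matrix (Fin n₁) (Fin n₂) ℝ
  /-- the row player's mixed strategy, fixed during an episode -/
  rowStrat : Fin K → Ω → Fin n₁ → ℝ
  /-- the column player's mixed strategy at each round -/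
  colStrat : Fin K → Fin T → Ω → Fin n₂ → ℝ
  /-- the row player's action at each round -/
  row : Fin K → Fin T → Ω → Fin n₁
  /-- the column player's action at each round -/
  col : Fin K → Fin T → Ω → Fin n₂
  /-- the observation noise at each round -/
  noise : Fin K → Fin T → Ω → ℝ

namespace GameProcess

variable {Ω : Type*} {S K T n₁ n₂ : ℕ}

/-- The ground truth game of episode `k`. -/
def game (G : GameProcess Ω S K T n₁ n₂) (k : Fin K) (ω : Ω) : Matrix (Fin n₁) (Fin n₂) ℝ :=
  mixGame (fun s => G.expert k s ω) (G.param ω)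

/-- The observed payoff: the entry of the true game at the actions played, plus noise. -/
def reward (G : GameProcess Ω S K T n₁ n₂) (k : Fin K) (t : Fin T) (ω : Ω) : ℝ :=
  G.game k ω (G.row k t ω) (G.col k t ω) + G.noise k t ω

/-- The side-information vector of the entry played: the entries of all expert games there. -/
def feature (G : GameProcess Ω S K T n₁ n₂) (k : Fin K) (t : Fin T) (ω : Ω) : Fin S → ℝ :=
  fun s => G.expert k s ω (G.row k t ω) (G.col k t ω)

/-- The σ-algebra of the public history before the round with (zero-based) number `t` of
episode `k`: actions and payoffs of all earlier rounds, and the expert games of all episodes up to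
and including `k`. -/
@[reducible] def history (G : GameProcess Ω S K T n₁ n₂) (k : Fin K) (t : ℕ) : MeasurableSpace Ω :=
  (⨆ (k' : Fin K) (t' : Fin T) (_ : k' < k ∨ (k' = k ∧ (t' : ℕ) < t)),
      MeasurableSpace.comap (fun ω => (G.row k' t' ω, G.col k' t' ω, G.reward k' t' ω))
        inferInstance) ⊔
    ⨆ (k' : Fin K) (_ : k' ≤ k),
      MeasurableSpace.comap (fun ω s a b => G.expert k' s ω a b)
        (inferInstanceAs (MeasurableSpace (Fin S → Fin n₁ → Fin n₂ → ℝ)))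

/-- History together with `θ*`; this is the history itself when `θ*` is a fixed vector. -/
@[reducible] def info (G : GameProcess Ω S K T n₁ n₂) (k : Fin K) (t : ℕ) : MeasurableSpace Ω :=
  G.history k t ⊔ MeasurableSpace.comap G.param inferInstance

/-- `info`, together with the two actions played in round `t` of episode `k`. -/
@[reducible] def infoActions (G : GameProcess Ω S K T n₁ n₂) (k : Fin K) (t : Fin T) : MeasurableSpace Ω :=
  G.info k t ⊔ MeasurableSpace.comap (fun ω => (G.row k t ω, G.col k t ω)) inferInstance

/-- `V_m = λ I + ∑ z zᵀ`, the sum being over all rounds of the first `m` episodes. -/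
def gram (G : GameProcess Ω S K T n₁ n₂) (lam : ℝ) (m : ℕ) (ω : Ω) :
    Matrix (Fin S) (Fin S) ℝ :=
  lam • (1 : Matrix (Fin S) (Fin S) ℝ) +
    ∑ k ∈ Finset.univ.filter (fun k : Fin K => k.val < m), ∑ t : Fin T,
      Matrix.vecMulVec (G.feature k t ω) (G.feature k t ω)

/-- `Y_m = ∑ r z`, the sum being over all rounds of the first `m` episodes. -/
def response (G : GameProcess Ω S K T n₁ n₂) (m : ℕ) (ω : Ω) : Fin S → ℝ :=
  ∑ k ∈ Finset.univ.filter (fun k : Fin K => k.val < m), ∑ t : Fin T, G.reward k t ω • G.feature k t ω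

/-- The regularized least squares estimate `V_m⁻¹ Y_m` from the first `m` episodes. -/
def estimate (G : GameProcess Ω S K T n₁ n₂) (lam : ℝ) (m : ℕ) (ω : Ω) : Fin S → ℝ :=
  (G.gram lam m ω)⁻¹.mulVec (G.response m ω)

/-- The squared radius
`(√(2 ln (det(V_m)^{1/2} det(λ I)^{-1/2} / δ)) + λ^{1/2} B)²`
of the confidence ellipsoid built from the first `m` episodes. -/
def radius (G : GameProcess Ω S K T n₁ n₂) (lam B δ : ℝ) (m : ℕ) (ω : Ω) : ℝ :=
  (√(2 * Real.log (√(G.gram lam m ω).det *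
      (√(lam • (1 : Matrix (Fin S) (Fin S) ℝ)).det)⁻¹ / δ)) + √lam * B) ^ 2

/-- The confidence ellipsoid built from the first `m` episodes. -/
def confSet (G : GameProcess Ω S K T n₁ n₂) (lam B δ : ℝ) (m : ℕ) (ω : Ω) :
    Set (Fin S → ℝ) :=
  {θ | (θ - G.estimate lam m ω) ⬝ᵥ (G.gram lam m ω).mulVec (θ - G.estimate lam m ω) ≤
    G.radius lam B δ m ω}

/-- The sum over all rounds of `val(M^{(k)}) - r_t^{(k)}`. -/
def realizedRegret (G : GameProcess Ω S K T n₁ n₂) (ω : Ω) : ℝ :=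
  ∑ k : Fin K, ∑ t : Fin T, (gameValue (G.game k ω) - G.reward k t ω)

/-- The saddle-point regret of the row player. -/
def saddlePointRegret [MeasurableSpace Ω] (G : GameProcess Ω S K T n₁ n₂) (P : Measure Ω) : ℝ :=
  ∫ ω, G.realizedRegret ω ∂P

end GameProcess

/-- The Euclidean ball `{θ : ‖θ‖² ≤ B²}` of parameters. -/
def paramBall (S : ℕ) (B : ℝ) : Set (Fin S → ℝ) := {θ | θ ⬝ᵥ θ ≤ B ^ 2}

/-- The rules of the interaction: expert games with entries in `[0,1]`; given the past, the two
actions of a round are drawn independently from the players' mixed strategies; given the past and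
the actions of the round, the noise is centred and `1`-sub-Gaussian. -/
structure IsInteraction {Ω : Type*} [MeasurableSpace Ω] {S K T n₁ n₂ : ℕ}
    (G : GameProcess Ω S K T n₁ n₂) (P : Measure Ω) : Prop where
  measurable_param : Measurable G.param
  measurable_expert : ∀ k s a b, Measurable fun ω => G.expert k s ω a b
  measurable_row : ∀ k t, Measurable (G.row k t)
  measurable_col : ∀ k t, Measurable (G.col k t)
  measurable_noise : ∀ k t, Measurable (G.noise k t)
  expert_mem : ∀ k s ω a b, G.expert k s ω a b ∈ Set.Icc (0 : ℝ) 1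
  rowStrat_mem : ∀ k ω, G.rowStrat k ω ∈ stdSimplex ℝ (Fin n₁)
  colStrat_mem : ∀ k t ω, G.colStrat k t ω ∈ stdSimplex ℝ (Fin n₂)
  sampling : ∀ k (t : Fin T) a b,
    P[Set.indicator {ω | G.row k t ω = a ∧ G.col k t ω = b} (fun _ => (1 : ℝ)) | G.info k t]
      =ᵐ[P] fun ω => G.rowStrat k ω a * G.colStrat k t ω b
  integrable_noise : ∀ k t, Integrable (G.noise k t) P
  noise_mean : ∀ k t, P[G.noise k t | G.infoActions k t] =ᵐ[P] fun _ => 0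
  integrable_exp_noise : ∀ k t (γ : ℝ), Integrable (fun ω => Real.exp (γ * G.noise k t ω)) P
  noise_subGaussian : ∀ k t (γ : ℝ),
    P[fun ω => Real.exp (γ * G.noise k t ω) | G.infoActions k t]
      ≤ᵐ[P] fun _ => Real.exp (γ ^ 2 / 2)

/-- The row player runs OFULinMat with parameters `λ, B, δ`: in every episode it picks an
optimistic parameter `θ'` from the confidence set intersected with the ball and plays a maximin
strategy of the corresponding game, both computed at the beginning of the episode. If the
intersection is empty, so that the rule says nothing, the strategy is left arbitrary. -/
structure IsOFULinMat {Ω : Type*} [MeasurableSpace Ω] {S K T n₁ n₂ : ℕ}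
    (G : GameProcess Ω S K T n₁ n₂) (P : Measure Ω) (lam B δ : ℝ) : Prop where
  measurable_rowStrat : ∀ k, Measurable[G.history k 0] (G.rowStrat k)
  optimistic : ∀ k : Fin K, ∀ᵐ ω ∂P,
    (G.confSet lam B δ k ω ∩ paramBall S B).Nonempty →
      ∃ θ' ∈ G.confSet lam B δ k ω ∩ paramBall S B,
        (∀ θ ∈ G.confSet lam B δ k ω ∩ paramBall S B,
          gameValue (mixGame (fun s => G.expert k s ω) θ) ≤
            gameValue (mixGame (fun s => G.expert k s ω) θ')) ∧
        IsMaximin (mixGame (fun s => G.expert k s ω) θ') (G.rowStrat k ω)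

/-- The true parameter lies in the ball with probability one. -/
def ParamInBall {Ω : Type*} [MeasurableSpace Ω] {S K T n₁ n₂ : ℕ}
    (G : GameProcess Ω S K T n₁ n₂) (P : Measure Ω) (B : ℝ) : Prop :=
  ∀ᵐ ω ∂P, G.param ω ∈ paramBall S B

/-- Regularity: against any opponent strategy the regret gap is at most `1`, and the determinant of
`V` grows in an episode by a factor of at most `κ`. -/
structure IsRegularGame {Ω : Type*} [MeasurableSpace Ω] {S K T n₁ n₂ : ℕ}
    (G : GameProcess Ω S K T n₁ n₂) (P : Measure Ω) (lam κ : ℝ) : Prop where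
  gap : ∀ᵐ ω ∂P, ∀ k : Fin K, ∀ y ∈ stdSimplex ℝ (Fin n₂),
    ∀ x₁ ∈ stdSimplex ℝ (Fin n₁), ∀ x₂ ∈ stdSimplex ℝ (Fin n₁),
      (x₁ - x₂) ⬝ᵥ (G.game k ω).mulVec y ≤ 1
  det_ratio : ∀ᵐ ω ∂P, ∀ k : Fin K,
    (G.gram lam ((k : ℕ) + 1) ω).det / (G.gram lam k ω).det ≤ κ

end

/-! The proof is optimism for a linear model. The observed payoff is `θ* ⬝ z` plus conditionally
sub-Gaussian noise, so `estimate` is a ridge regression estimate. Its error in the `V`-norm is at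
most `√λ B` plus the self-normalized noise `‖E‖` in the `V⁻¹`-norm, where `E = ∑ η z`
(`PosDef.sqrt_ridge_error_le`).

The noise is controlled by the process `exp(‖E‖² / 2) / √(det V)`, a supermartingale
(`lintegral_mixtureMartingale_le`). Each of its increments is bounded by mixing `exp(γ η)` over a
scalar Gaussian `γ`, so no Gaussian integral over the parameter space occurs. Markov's inequality
then shows that the ellipsoid of a given episode misses `θ*` with probability at most `δ`.

If `θ*` is in the ellipsoid, the optimistic value dominates the true one. A maximin strategy secures
it against every column strategy, and replacing the optimistic parameter by `θ*` costs the expected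
`width` of the entry played (`IsOFULinMat.gameValue_le`). If not, the gap hypothesis bounds the loss
of a round by `1`. With `δ = 1/(KT)` the `KT` rounds lose at most `1` this way in total, so neither
a union bound nor a time-uniform bound is needed.

The widths are summed by Cauchy–Schwarz and an elliptical potential argument. `V` is frozen during
an episode, and the determinant ratio hypothesis limits the price of this to a factor `κ`
(`sum_invForm_feature_le`). The radius and the potential each contribute about `√(S ln(KTS))`, the
number of rounds contributes `√(KT)`. -/

noncomputable section

open ProbabilityTheory Filter Matrix
open scoped ENNReal NNReal Topology

/-! ### Linear algebra: the `V⁻¹`-norm, rank-one updates and ridge regression. -/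

namespace Matrix

variable {ι : Type*} [Fintype ι]

lemma dotProduct_mulVec_comm {A : Matrix ι ι ℝ} (hA : A.IsHermitian) (x y : ι → ℝ) :
    x ⬝ᵥ A *ᵥ y = y ⬝ᵥ A *ᵥ x := by
  have h : Aᵀ = A := by simpa [IsHermitian, conjTranspose_eq_transpose_of_trivial] using hA
  rw [dotProduct_mulVec, ← mulVec_transpose, h, dotProduct_comm]

/-- Cauchy–Schwarz for a positive semidefinite matrix. -/
lemma PosSemidef.dotProduct_mulVec_sq_le {A : Matrix ι ι ℝ} (hA : A.PosSemidef) (x y : ι → ℝ) :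
    (x ⬝ᵥ A *ᵥ y) ^ 2 ≤ (x ⬝ᵥ A *ᵥ x) * (y ⬝ᵥ A *ᵥ y) := by
  have h : ∀ c : ℝ, 0 ≤ (y ⬝ᵥ A *ᵥ y) * (c * c) + (2 * (x ⬝ᵥ A *ᵥ y)) * c + x ⬝ᵥ A *ᵥ x := by
    intro c
    have h0 := hA.dotProduct_mulVec_nonneg (x + c • y)
    have hs : y ⬝ᵥ A *ᵥ x = x ⬝ᵥ A *ᵥ y := dotProduct_mulVec_comm hA.1 y x
    simp only [star_trivial, mulVec_add, mulVec_smul, dotProduct_add, add_dotProduct,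
      smul_dotProduct, dotProduct_smul, smul_eq_mul, hs] at h0
    linarith
  have := discrim_le_zero h
  rw [discrim] at this
  nlinarith

lemma PosDef.add_vecMulVec_self {V : Matrix ι ι ℝ} (hV : V.PosDef) (z : ι → ℝ) :
    (V + vecMulVec z z).PosDef := by
  have := posSemidef_vecMulVec_self_star (R := ℝ) z
  rw [star_trivial] at this
  exact hV.add_posSemidef this

variable [DecidableEq ι]

/-- The bilinear form `xᵀ V⁻¹ y`. -/
def invForm (V : Matrix ι ι ℝ) (x y : ι → ℝ) : ℝ := x ⬝ᵥ V⁻¹ *ᵥ y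

lemma invForm_add_left (V : Matrix ι ι ℝ) (x x' y : ι → ℝ) :
    invForm V (x + x') y = invForm V x y + invForm V x' y := add_dotProduct _ _ _

lemma invForm_smul_left (V : Matrix ι ι ℝ) (c : ℝ) (x y : ι → ℝ) :
    invForm V (c • x) y = c * invForm V x y := by
  simp [invForm, smul_dotProduct]

lemma invForm_add_right (V : Matrix ι ι ℝ) (x y y' : ι → ℝ) :
    invForm V x (y + y') = invForm V x y + invForm V x y' := by
  simp [invForm, mulVec_add, dotProduct_add]

lemma invForm_smul_right (V : Matrix ι ι ℝ) (c : ℝ) (x y : ι → ℝ) :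
    invForm V x (c • y) = c * invForm V x y := by
  simp [invForm, mulVec_smul, dotProduct_smul]

lemma PosDef.invForm_comm {V : Matrix ι ι ℝ} (hV : V.PosDef) (x y : ι → ℝ) :
    invForm V x y = invForm V y x := dotProduct_mulVec_comm hV.inv.1 x y

lemma PosDef.invForm_self_nonneg {V : Matrix ι ι ℝ} (hV : V.PosDef) (x : ι → ℝ) :
    0 ≤ invForm V x x := by
  simpa [invForm] using hV.inv.posSemidef.dotProduct_mulVec_nonneg x

lemma PosDef.mul_inv_cancel {V : Matrix ι ι ℝ} (hV : V.PosDef) : V * V⁻¹ = 1 :=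
  mul_nonsing_inv V hV.det_pos.ne'.isUnit

lemma PosDef.inv_mul_cancel {V : Matrix ι ι ℝ} (hV : V.PosDef) : V⁻¹ * V = 1 :=
  nonsing_inv_mul V hV.det_pos.ne'.isUnit

lemma PosDef.invForm_sq_le {V : Matrix ι ι ℝ} (hV : V.PosDef) (x y : ι → ℝ) :
    invForm V x y ^ 2 ≤ invForm V x x * invForm V y y :=
  hV.inv.posSemidef.dotProduct_mulVec_sq_le x y

/-- Duality of the `V`- and `V⁻¹`-norms: write `z = V (V⁻¹ z)` and apply Cauchy–Schwarz for `V`. -/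
lemma PosDef.dotProduct_sq_le {V : Matrix ι ι ℝ} (hV : V.PosDef) (x z : ι → ℝ) :
    (x ⬝ᵥ z) ^ 2 ≤ (x ⬝ᵥ V *ᵥ x) * invForm V z z := by
  have h := hV.posSemidef.dotProduct_mulVec_sq_le x (V⁻¹ *ᵥ z)
  rw [mulVec_mulVec, hV.mul_inv_cancel, one_mulVec, dotProduct_comm (V⁻¹ *ᵥ z) z] at h
  exact h

omit [DecidableEq ι] in
lemma PosDef.add_sum_vecMulVec_self {V : Matrix ι ι ℝ} (hV : V.PosDef) {α : Type*}
    (s : Finset α) (z : α → ι → ℝ) : (V + ∑ i ∈ s, vecMulVec (z i) (z i)).PosDef := by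
  classical
  induction s using Finset.induction_on with
  | empty => simpa using hV
  | insert a s ha ih =>
    rw [Finset.sum_insert ha, add_left_comm, add_comm]
    exact ih.add_vecMulVec_self _

lemma PosDef.det_add_vecMulVec_self {V : Matrix ι ι ℝ} (hV : V.PosDef) (z : ι → ℝ) :
    (V + vecMulVec z z).det = V.det * (1 + invForm V z z) := by
  have h : V + vecMulVec z z = V * (1 + replicateCol Unit (V⁻¹ *ᵥ z) * replicateRow Unit z) := by
    rw [mul_add, mul_one, ← vecMulVec_eq, mul_vecMulVec, mulVec_mulVec, hV.mul_inv_cancel,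
      one_mulVec]
  rw [h, det_mul, det_one_add_replicateCol_mul_replicateRow]
  rfl

/-- The Sherman–Morrison formula, as an identity of quadratic forms. -/
lemma PosDef.invForm_add_vecMulVec_self {V : Matrix ι ι ℝ} (hV : V.PosDef) (z x y : ι → ℝ) :
    invForm (V + vecMulVec z z) x y =
      invForm V x y - invForm V x z * invForm V z y / (1 + invForm V z z) := by
  have hW := hV.add_vecMulVec_self z
  have ha : 1 + invForm V z z ≠ 0 := by have := hV.invForm_self_nonneg z; positivity
  set c := invForm V z y / (1 + invForm V z z) with hc
  have hc' : c * (1 + invForm V z z) = invForm V z y := by rw [hc]; field_simp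
  have key : (V + vecMulVec z z) *ᵥ (V⁻¹ *ᵥ y - c • V⁻¹ *ᵥ z) = y := by
    rw [add_mulVec, mulVec_sub, mulVec_smul, mulVec_mulVec, mulVec_mulVec, hV.mul_inv_cancel,
      one_mulVec, one_mulVec, vecMulVec_mulVec, dotProduct_sub, dotProduct_smul]
    change y - c • z + MulOpposite.op (invForm V z y - c • invForm V z z) • z = y
    rw [← hc']
    ext i
    simp
    ring
  have h2 : (V + vecMulVec z z)⁻¹ *ᵥ y = V⁻¹ *ᵥ y - c • V⁻¹ *ᵥ z := by
    conv_lhs => rw [← key]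
    rw [mulVec_mulVec, hW.inv_mul_cancel, one_mulVec]
  rw [invForm, h2, dotProduct_sub, dotProduct_smul, hc]
  change invForm V x y - _ * invForm V x z = _
  ring

/-- Adding rank-one terms multiplies the determinant at least by one plus the sum of their squared
`V⁻¹`-norms. -/
lemma det_mul_one_add_sum_invForm_le {α : Type*} (s : Finset α) (z : α → ι → ℝ)
    {V : Matrix ι ι ℝ} (hV : V.PosDef) :
    V.det * (1 + ∑ i ∈ s, invForm V (z i) (z i)) ≤
      (V + ∑ i ∈ s, vecMulVec (z i) (z i)).det := by
  classical
  induction s using Finset.induction_on generalizing V with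
  | empty => simp
  | insert a s ha ih =>
    -- The new vector is absorbed into `V` and the induction hypothesis is used for the enlarged
    -- matrix, which is why `V` is generalized.
    have hW := hV.add_vecMulVec_self (z a)
    have h := ih hW
    rw [Finset.sum_insert ha, Finset.sum_insert ha, ← add_assoc V]
    refine le_trans ?_ h
    rw [hV.det_add_vecMulVec_self, mul_assoc]
    refine mul_le_mul_of_nonneg_left ?_ hV.det_pos.le
    have ha0 := hV.invForm_self_nonneg (z a)
    -- Passing to the enlarged matrix shrinks the norms of the other vectors. By Cauchy–Schwarz this
    -- loss, once multiplied by `1 + ‖z a‖²`, is at most the cross term `‖z a‖² ∑ ‖z i‖²` of the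
    -- product.
    have hs : ∑ i ∈ s, invForm V (z i) (z a) ^ 2 ≤
        invForm V (z a) (z a) * ∑ i ∈ s, invForm V (z i) (z i) := by
      rw [Finset.mul_sum]
      refine Finset.sum_le_sum fun i _ => ?_
      rw [mul_comm]
      exact hV.invForm_sq_le _ _
    have he : ∑ i ∈ s, invForm (V + vecMulVec (z a) (z a)) (z i) (z i) =
        ∑ i ∈ s, invForm V (z i) (z i) -
          (∑ i ∈ s, invForm V (z i) (z a) ^ 2) / (1 + invForm V (z a) (z a)) := by
      rw [Finset.sum_div, ← Finset.sum_sub_distrib]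
      refine Finset.sum_congr rfl fun i _ => ?_
      rw [hV.invForm_add_vecMulVec_self, hV.invForm_comm (z a) (z i), sq]
    rw [he, mul_add, mul_sub, mul_div_cancel₀ _ (by positivity)]
    nlinarith

/-- This is `V ≥ λ I ⇒ V⁻¹ ≤ λ⁻¹ I`. Test the hypothesis on `V⁻¹ z`, combine with Euclidean
Cauchy–Schwarz and cancel one factor `invForm V z z`. -/
lemma PosDef.invForm_self_le {V : Matrix ι ι ℝ} (hV : V.PosDef) {lam : ℝ} (hlam : 0 < lam)
    (h : ∀ x : ι → ℝ, lam * (x ⬝ᵥ x) ≤ x ⬝ᵥ V *ᵥ x) (z : ι → ℝ) :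
    lam * invForm V z z ≤ z ⬝ᵥ z := by
  have h1 := h (V⁻¹ *ᵥ z)
  rw [mulVec_mulVec, hV.mul_inv_cancel, one_mulVec, dotProduct_comm _ z] at h1
  change _ ≤ invForm V z z at h1
  have h2 : invForm V z z ^ 2 ≤ (z ⬝ᵥ z) * ((V⁻¹ *ᵥ z) ⬝ᵥ (V⁻¹ *ᵥ z)) := by
    simpa [invForm] using (PosDef.one (n := ι) (R := ℝ)).posSemidef.dotProduct_mulVec_sq_le z
      (V⁻¹ *ᵥ z)
  have h0 := hV.invForm_self_nonneg z
  have h3 : 0 ≤ z ⬝ᵥ z := by simpa using dotProduct_star_self_nonneg z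
  rcases h0.eq_or_lt with h0 | h0
  · rw [← h0]; simpa using h3
  · have : lam * invForm V z z * invForm V z z ≤ (z ⬝ᵥ z) * invForm V z z := by nlinarith
    exact le_of_mul_le_mul_right this h0

/-- Each eigenvalue is at most the trace. The arithmetic–geometric mean inequality would be sharper,
but the bound is only used inside a logarithm. -/
lemma PosDef.det_le_trace_pow {V : Matrix ι ι ℝ} (hV : V.PosDef) :
    V.det ≤ V.trace ^ Fintype.card ι := by
  rw [hV.1.det_eq_prod_eigenvalues, hV.1.trace_eq_sum_eigenvalues]
  refine (Finset.prod_le_prod (fun i _ => ?_) (fun i _ => ?_)).trans_eq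
    (Finset.prod_const (s := Finset.univ) _)
  · exact (hV.eigenvalues_pos i).le
  · exact Finset.single_le_sum (f := fun i => (hV.1.eigenvalues i : ℝ))
      (fun j _ => (hV.eigenvalues_pos j).le) (Finset.mem_univ i)

/-- The prediction error of ridge regression, for the norm given by the regularized Gram matrix. -/
lemma PosDef.sqrt_ridge_error_le {V A : Matrix ι ι ℝ} (hV : V.PosDef) {lam : ℝ} (hlam : 0 < lam)
    (hVA : V = lam • 1 + A) (h : ∀ x : ι → ℝ, lam * (x ⬝ᵥ x) ≤ x ⬝ᵥ V *ᵥ x)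
    (θ e : ι → ℝ) {B : ℝ} (hB : 0 ≤ B) (hθ : θ ⬝ᵥ θ ≤ B ^ 2) :
    (θ - V⁻¹ *ᵥ (A *ᵥ θ + e)) ⬝ᵥ V *ᵥ (θ - V⁻¹ *ᵥ (A *ᵥ θ + e)) ≤
      (√(invForm V e e) + √lam * B) ^ 2 := by
  -- Since `θ = V⁻¹ V θ` and `V - A = λ I`, the error splits into the regularization bias and the
  -- noise.
  have h1 : θ - V⁻¹ *ᵥ (A *ᵥ θ + e) = V⁻¹ *ᵥ (lam • θ + (-1 : ℝ) • e) := by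
    have : V⁻¹ *ᵥ (V *ᵥ θ) = θ := by rw [mulVec_mulVec, hV.inv_mul_cancel, one_mulVec]
    conv_lhs => enter [1]; rw [← this]
    rw [← mulVec_sub]
    congr 1
    conv_lhs => enter [1]; rw [hVA]
    rw [add_mulVec, smul_mulVec, one_mulVec]
    ext i
    simp
    ring
  have h2 : (θ - V⁻¹ *ᵥ (A *ᵥ θ + e)) ⬝ᵥ V *ᵥ (θ - V⁻¹ *ᵥ (A *ᵥ θ + e)) =
      invForm V (lam • θ + (-1 : ℝ) • e) (lam • θ + (-1 : ℝ) • e) := by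
    rw [h1, mulVec_mulVec, hV.mul_inv_cancel, one_mulVec, dotProduct_comm]
    rfl
  have hcs := hV.invForm_sq_le e θ
  have hbd := hV.invForm_self_le hlam h θ
  have he := hV.invForm_self_nonneg e
  have ht := hV.invForm_self_nonneg θ
  rw [h2, invForm_add_left, invForm_add_right, invForm_add_right, invForm_smul_left,
    invForm_smul_left, invForm_smul_left, invForm_smul_left, invForm_smul_right,
    invForm_smul_right, invForm_smul_right, invForm_smul_right, hV.invForm_comm θ e]
  have hl : √lam ^ 2 = lam := Real.sq_sqrt hlam.le
  have hs : √(invForm V e e) ^ 2 = invForm V e e := Real.sq_sqrt he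
  have hlb : lam * invForm V θ θ ≤ B ^ 2 := hbd.trans hθ
  -- Bounding the cross term by Cauchy–Schwarz and `λ ‖θ‖² ≤ B²` in the `V⁻¹`-norm completes the
  -- square on the right.
  have h3 : lam * (-invForm V e θ) ≤ √(invForm V e e) * (√lam * B) := by
    refine le_of_sq_le_sq ?_ (by positivity)
    rw [mul_pow, mul_pow, mul_pow, hs, hl, neg_sq]
    nlinarith [mul_le_mul_of_nonneg_left hlb (mul_nonneg hlam.le he)]
  nlinarith

end Matrix

/-! ### Sub-Gaussian laws: scalar Gaussian mixtures and conditional integration. -/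

/-- The law `ρ` on the real line has the moment generating function of a `1`-sub-Gaussian one. -/
def SubGaussianLaw (ρ : Measure ℝ) : Prop :=
  ∀ γ : ℝ, ∫⁻ y, ENNReal.ofReal (Real.exp (γ * y)) ∂ρ ≤ ENNReal.ofReal (Real.exp (γ ^ 2 / 2))

/-- Complete the square: the weight `exp(γ²/2)` lowers the precision `(1 + a)/a` by one to `1/a`, so
the integrand is a constant times the density of a Gaussian with mean `b` and variance `a`. -/
lemma lintegral_exp_sq_gaussianReal {a b : ℝ} (ha : 0 < a) :
    ∫⁻ γ, ENNReal.ofReal (Real.exp (γ ^ 2 / 2))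
        ∂(gaussianReal (b / (1 + a)) (Real.toNNReal (a / (1 + a)))) =
      ENNReal.ofReal (√(1 + a) * Real.exp (b ^ 2 / (2 * (1 + a)))) := by
  have hv : Real.toNNReal (a / (1 + a)) ≠ 0 := by
    simp only [ne_eq, Real.toNNReal_eq_zero, not_le]; positivity
  have ha' : Real.toNNReal a ≠ 0 := by simpa using ha
  rw [gaussianReal_of_var_ne_zero _ hv,
    lintegral_withDensity_eq_lintegral_mul _ (measurable_gaussianPDF _ _) (by fun_prop)]
  have h : ∀ γ, (gaussianPDF (b / (1 + a)) (Real.toNNReal (a / (1 + a))) *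
      fun γ => ENNReal.ofReal (Real.exp (γ ^ 2 / 2))) γ =
      ENNReal.ofReal (√(1 + a) * Real.exp (b ^ 2 / (2 * (1 + a)))) *
        gaussianPDF b (Real.toNNReal a) γ := by
    intro γ
    rw [Pi.mul_apply, gaussianPDF, gaussianPDF, ← ENNReal.ofReal_mul (gaussianPDFReal_nonneg _ _ _),
      ← ENNReal.ofReal_mul (by positivity)]
    congr 1
    rw [gaussianPDFReal, gaussianPDFReal, Real.coe_toNNReal _ (by positivity),
      Real.coe_toNNReal _ ha.le]
    have h1 : (√(2 * Real.pi * (a / (1 + a))))⁻¹ = √(1 + a) * (√(2 * Real.pi * a))⁻¹ := by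
      rw [← mul_div_assoc, Real.sqrt_div (by positivity), inv_div, div_eq_mul_inv]
    rw [h1, mul_assoc, mul_assoc, ← Real.exp_add]
    have h2 : -(γ - b / (1 + a)) ^ 2 / (2 * (a / (1 + a))) + γ ^ 2 / 2 =
        b ^ 2 / (2 * (1 + a)) + -(γ - b) ^ 2 / (2 * a) := by
      field_simp
      ring
    rw [h2, Real.exp_add]
    ring
  rw [lintegral_congr h, lintegral_const_mul _ (measurable_gaussianPDF _ _),
    lintegral_gaussianPDF_eq_one _ ha', mul_one]

/-- The mixture of exponential supermartingales over a Gaussian prior, for one observation. -/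
lemma SubGaussianLaw.lintegral_exp_quadratic_le {ρ : Measure ℝ} [IsProbabilityMeasure ρ]
    (hρ : SubGaussianLaw ρ) {a : ℝ} (ha : 0 ≤ a) (b : ℝ) :
    ∫⁻ y, ENNReal.ofReal (Real.exp ((2 * b * y + a * y ^ 2 - b ^ 2) / (2 * (1 + a)))) ∂ρ ≤
      ENNReal.ofReal √(1 + a) := by
  have hsplit : ∀ y, ENNReal.ofReal (Real.exp ((2 * b * y + a * y ^ 2 - b ^ 2) / (2 * (1 + a)))) =
      ENNReal.ofReal (Real.exp (-b ^ 2 / (2 * (1 + a)))) *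
        ENNReal.ofReal (Real.exp (b / (1 + a) * y + a / (1 + a) * y ^ 2 / 2)) := by
    intro y
    rw [← ENNReal.ofReal_mul (Real.exp_nonneg _), ← Real.exp_add]
    congr 2
    field_simp
    ring
  rw [lintegral_congr hsplit, lintegral_const_mul _ (by fun_prop)]
  have hmix : ∫⁻ y, ENNReal.ofReal (Real.exp (b / (1 + a) * y + a / (1 + a) * y ^ 2 / 2)) ∂ρ ≤
      ENNReal.ofReal (√(1 + a) * Real.exp (b ^ 2 / (2 * (1 + a)))) := by
    -- For `a = 0` the mixing law is a point mass without density, and the claim is the hypothesis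
    -- at `γ = b`.
    rcases ha.eq_or_lt with rfl | ha
    · simpa using hρ b
    -- The left side is the Gaussian moment generating function at `y`. Tonelli then lets the
    -- sub-Gaussian bound act for each fixed `γ`.
    have hg : ∀ y, ENNReal.ofReal (Real.exp (b / (1 + a) * y + a / (1 + a) * y ^ 2 / 2)) =
        ∫⁻ γ, ENNReal.ofReal (Real.exp (γ * y))
          ∂(gaussianReal (b / (1 + a)) (Real.toNNReal (a / (1 + a)))) := by
      intro y
      have h1 := mgf_gaussianReal (p := gaussianReal (b / (1 + a)) (Real.toNNReal (a / (1 + a))))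
        (X := id) (by rw [Measure.map_id]) y
      rw [Real.coe_toNNReal _ (by positivity)] at h1
      rw [← h1, mgf, ofReal_integral_eq_lintegral_ofReal]
      · simp only [id, mul_comm]
      · exact integrable_exp_mul_gaussianReal y
      · exact ae_of_all _ fun _ => Real.exp_nonneg _
    rw [lintegral_congr hg, lintegral_lintegral_swap (by fun_prop)]
    exact (lintegral_mono fun γ => hρ γ).trans_eq (lintegral_exp_sq_gaussianReal ha)
  refine (mul_le_mul_right hmix _).trans_eq ?_
  rw [← ENNReal.ofReal_mul (Real.exp_nonneg _), mul_left_comm, ← Real.exp_add]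
  congr 1
  rw [neg_div, neg_add_cancel, Real.exp_zero, mul_one]

/-- Conditional bounds hold almost surely for each exponent separately, so only countably many can
be used at once; Fatou's lemma recovers the real ones. -/
lemma subGaussianLaw_of_forall_rat {ρ : Measure ℝ}
    (h : ∀ q : ℚ, ∫⁻ y, ENNReal.ofReal (Real.exp (q * y)) ∂ρ ≤
      ENNReal.ofReal (Real.exp ((q : ℝ) ^ 2 / 2))) : SubGaussianLaw ρ := by
  intro γ
  have hd : DenseRange ((↑) : ℚ → ℝ) := Rat.denseRange_cast
  obtain ⟨u, hu, hlim⟩ := mem_closure_iff_seq_limit.1 (hd γ)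
  choose q hq using hu
  have hl : ∀ y, liminf (fun n => ENNReal.ofReal (Real.exp (u n * y))) atTop =
      ENNReal.ofReal (Real.exp (γ * y)) := fun y =>
    Tendsto.liminf_eq (ENNReal.tendsto_ofReal
      ((Real.continuous_exp.tendsto _).comp (hlim.mul_const y)))
  have hr : Tendsto (fun n => ENNReal.ofReal (Real.exp (u n ^ 2 / 2))) atTop
      (𝓝 (ENNReal.ofReal (Real.exp (γ ^ 2 / 2)))) :=
    ENNReal.tendsto_ofReal ((Real.continuous_exp.tendsto _).comp ((hlim.pow 2).div_const 2))
  calc ∫⁻ y, ENNReal.ofReal (Real.exp (γ * y)) ∂ρ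
      = ∫⁻ y, liminf (fun n => ENNReal.ofReal (Real.exp (u n * y))) atTop ∂ρ :=
        lintegral_congr fun y => (hl y).symm
    _ ≤ liminf (fun n => ∫⁻ y, ENNReal.ofReal (Real.exp (u n * y)) ∂ρ) atTop :=
        lintegral_liminf_le fun n => by fun_prop
    _ ≤ liminf (fun n => ENNReal.ofReal (Real.exp (u n ^ 2 / 2))) atTop :=
        liminf_le_liminf (Eventually.of_forall fun n => by
          have := h (q n)
          rwa [hq n] at this)
    _ = _ := hr.liminf_eq

/-- Integrating out a conditionally sub-Gaussian variable, the past being frozen. -/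
lemma lintegral_le_of_condSubGaussian_comap {Ω β : Type*} [MeasurableSpace Ω] [mβ : MeasurableSpace β]
    {P : Measure Ω} [IsProbabilityMeasure P] {X : Ω → β} (hX : Measurable X) {η : Ω → ℝ}
    (hη : Measurable η) (hint : ∀ γ : ℝ, Integrable (fun ω => Real.exp (γ * η ω)) P)
    (hsub : ∀ γ : ℝ, P[fun ω => Real.exp (γ * η ω) | mβ.comap X] ≤ᵐ[P]
      fun _ => Real.exp (γ ^ 2 / 2))
    {f : β × ℝ → ℝ≥0∞} (hf : Measurable f) {g : β → ℝ≥0∞}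
    (hfg : ∀ x, ∀ ρ : Measure ℝ, IsProbabilityMeasure ρ → SubGaussianLaw ρ →
      ∫⁻ y, f (x, y) ∂ρ ≤ g x) :
    ∫⁻ ω, f (X ω, η ω) ∂P ≤ ∫⁻ ω, g (X ω) ∂P := by
  -- The conditional moment bounds become a statement about the regular conditional law of `η`.
  have hlaw : ∀ᵐ ω ∂P, SubGaussianLaw (condDistrib η X P (X ω)) := by
    have h1 : ∀ q : ℚ, ∀ᵐ ω ∂P,
        ∫⁻ y, ENNReal.ofReal (Real.exp (q * y)) ∂(condDistrib η X P (X ω)) ≤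
          ENNReal.ofReal (Real.exp ((q : ℝ) ^ 2 / 2)) := by
      intro q
      have hsm : StronglyMeasurable (fun y : ℝ => Real.exp (q * y)) :=
        (by fun_prop : Measurable fun y : ℝ => Real.exp (q * y)).stronglyMeasurable
      have e1 := condExp_ae_eq_integral_condDistrib hX hη.aemeasurable hsm (hint q)
      have hmap : Integrable (fun x : β × ℝ => Real.exp (q * x.2))
          (P.map (fun ω => (X ω, η ω))) := by
        rw [integrable_map_measure]
        · exact hint q
        · exact (hsm.comp_measurable measurable_snd).aestronglyMeasurable
        · exact (hX.prodMk hη).aemeasurable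
      filter_upwards [e1, hmap.condDistrib_ae hX.aemeasurable hη.aemeasurable, hsub q]
        with ω w1 w2 w3
      rw [← ofReal_integral_eq_lintegral_ofReal w2 (ae_of_all _ fun _ => Real.exp_nonneg _)]
      exact ENNReal.ofReal_le_ofReal (w1 ▸ w3)
    filter_upwards [ae_all_iff.2 h1] with ω hω
    exact subGaussianLaw_of_forall_rat hω
  calc ∫⁻ ω, f (X ω, η ω) ∂P
      = ∫⁻ x, f x ∂(P.map (fun ω => (X ω, η ω))) := (lintegral_map hf (hX.prodMk hη)).symm
    _ = ∫⁻ ω, ∫⁻ y, f (X ω, y) ∂(condDistrib η X P (X ω)) ∂P := by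
        rw [← compProd_map_condDistrib hη.aemeasurable, Measure.lintegral_compProd hf,
          lintegral_map (Measurable.lintegral_kernel_prod_right' hf) hX]
    _ ≤ ∫⁻ ω, g (X ω) ∂P := lintegral_mono_ae (hlaw.mono fun ω hω => hfg _ _ inferInstance hω)

/-- Conditioning on a sub-σ-algebra is conditioning on the identity map into `Ω` equipped with `m`.
-/
lemma lintegral_le_of_condSubGaussian {Ω : Type*} {m mΩ : MeasurableSpace Ω} (hm : m ≤ mΩ)
    {P : Measure Ω} [IsProbabilityMeasure P] {η : Ω → ℝ} (hη : Measurable η)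
    (hint : ∀ γ : ℝ, Integrable (fun ω => Real.exp (γ * η ω)) P)
    (hsub : ∀ γ : ℝ, P[fun ω => Real.exp (γ * η ω) | m] ≤ᵐ[P] fun _ => Real.exp (γ ^ 2 / 2))
    {f : Ω × ℝ → ℝ≥0∞} (hf : Measurable[m.prod inferInstance] f) {g : Ω → ℝ≥0∞}
    (hfg : ∀ ω, ∀ ρ : Measure ℝ, IsProbabilityMeasure ρ → SubGaussianLaw ρ →
      ∫⁻ y, f (ω, y) ∂ρ ≤ g ω) :
    ∫⁻ ω, f (ω, η ω) ∂P ≤ ∫⁻ ω, g ω ∂P := by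
  rw [← m.comap_id] at hsub
  exact @lintegral_le_of_condSubGaussian_comap Ω Ω mΩ m P _ id (measurable_id'' hm) η hη hint hsub
    f hf g hfg

/-! ### Measurability of determinants, inverses and quadratic forms. -/

section Measurability

variable {Ω ι : Type*} [MeasurableSpace Ω] [Fintype ι]

lemma measurable_dotProduct {x y : Ω → ι → ℝ} (hx : Measurable x) (hy : Measurable y) :
    Measurable fun ω => x ω ⬝ᵥ y ω := by
  simp only [dotProduct]
  fun_prop

variable [DecidableEq ι]

lemma measurable_matrix_det {A : Ω → Matrix ι ι ℝ} (hA : ∀ i j, Measurable fun ω => A ω i j) :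
    Measurable fun ω => (A ω).det := by
  simp only [det_apply]
  fun_prop

lemma measurable_matrix_inv {A : Ω → Matrix ι ι ℝ} (hA : ∀ i j, Measurable fun ω => A ω i j)
    (i j : ι) : Measurable fun ω => (A ω)⁻¹ i j := by
  have h : ∀ ω, (A ω)⁻¹ i j = (A ω).det⁻¹ * ((A ω).updateRow j (Pi.single i 1)).det := fun ω => by
    rw [inv_def, Ring.inverse_eq_inv', Matrix.smul_apply, smul_eq_mul, adjugate_apply]
  simp only [h]
  refine (measurable_matrix_det hA).inv.mul (measurable_matrix_det fun k l => ?_)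
  by_cases hk : k = j
  · subst hk; simp
  · simpa [hk] using hA k l

lemma measurable_invForm {A : Ω → Matrix ι ι ℝ} (hA : ∀ i j, Measurable fun ω => A ω i j)
    {x y : Ω → ι → ℝ} (hx : Measurable x) (hy : Measurable y) :
    Measurable fun ω => invForm (A ω) (x ω) (y ω) := by
  have h := measurable_matrix_inv hA
  have hy' : ∀ j, Measurable fun ω => y ω j := fun j => (measurable_pi_apply j).comp hy
  have hAy : Measurable fun ω => (A ω)⁻¹ *ᵥ y ω := by
    refine measurable_pi_iff.2 fun i => ?_
    exact Finset.measurable_sum _ fun j _ => (h i j).mul (hy' j)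
  simp only [invForm]
  exact measurable_dotProduct hx hAy

end Measurability

/-! ### The self-normalized exponential process. -/

section SelfNormalized

variable {ι : Type*} [Fintype ι] [DecidableEq ι] {α Ω : Type*}

/-- The regularized Gram matrix of the vectors `z i`, `i ∈ s`. -/
def ridgeGram (lam : ℝ) (z : α → Ω → ι → ℝ) (s : Finset α) (ω : Ω) : Matrix ι ι ℝ :=
  lam • (1 : Matrix ι ι ℝ) + ∑ i ∈ s, vecMulVec (z i ω) (z i ω)

/-- The noise accumulated along the vectors `z i`, `i ∈ s`. -/
def noiseSum (η : α → Ω → ℝ) (z : α → Ω → ι → ℝ) (s : Finset α) (ω : Ω) : ι → ℝ :=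
  ∑ i ∈ s, η i ω • z i ω

lemma posDef_ridgeGram {lam : ℝ} (hlam : 0 < lam) (z : α → Ω → ι → ℝ) (s : Finset α) (ω : Ω) :
    (ridgeGram lam z s ω).PosDef :=
  (PosDef.one.smul hlam).add_sum_vecMulVec_self s fun i => z i ω

/-- The mixture of exponential supermartingales with a Gaussian prior (up to normalization). -/
def mixtureMartingale (lam : ℝ) (η : α → Ω → ℝ) (z : α → Ω → ι → ℝ) (s : Finset α) (ω : Ω) : ℝ :=
  Real.exp (invForm (ridgeGram lam z s ω) (noiseSum η z s ω) (noiseSum η z s ω) / 2) /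
    √(ridgeGram lam z s ω).det

lemma mixtureMartingale_nonneg (lam : ℝ) (η : α → Ω → ℝ) (z : α → Ω → ι → ℝ) (s : Finset α)
    (ω : Ω) : 0 ≤ mixtureMartingale lam η z s ω := by
  unfold mixtureMartingale; positivity

variable [DecidableEq α]

/-- The determinant formula and Sherman–Morrison isolate the newest noise term in exactly the
integrand of `SubGaussianLaw.lintegral_exp_quadratic_le`. -/
lemma mixtureMartingale_insert {lam : ℝ} (hlam : 0 < lam) (η : α → Ω → ℝ) (z : α → Ω → ι → ℝ)
    {s : Finset α} {a : α} (ha : a ∉ s) (ω : Ω) :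
    mixtureMartingale lam η z (insert a s) ω =
      mixtureMartingale lam η z s ω / √(1 + invForm (ridgeGram lam z s ω) (z a ω) (z a ω)) *
        Real.exp ((2 * invForm (ridgeGram lam z s ω) (noiseSum η z s ω) (z a ω) * η a ω +
          invForm (ridgeGram lam z s ω) (z a ω) (z a ω) * η a ω ^ 2 -
          invForm (ridgeGram lam z s ω) (noiseSum η z s ω) (z a ω) ^ 2) /
            (2 * (1 + invForm (ridgeGram lam z s ω) (z a ω) (z a ω)))) := by
  have hV := posDef_ridgeGram hlam z s ω
  have h0 := hV.invForm_self_nonneg (z a ω)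
  have hins : ridgeGram lam z (insert a s) ω =
      ridgeGram lam z s ω + vecMulVec (z a ω) (z a ω) := by
    rw [ridgeGram, ridgeGram, Finset.sum_insert ha]; abel
  have hE : noiseSum η z (insert a s) ω = noiseSum η z s ω + η a ω • z a ω := by
    rw [noiseSum, noiseSum, Finset.sum_insert ha, add_comm]
  rw [mixtureMartingale, mixtureMartingale, hins, hE, hV.det_add_vecMulVec_self,
    hV.invForm_add_vecMulVec_self, Real.sqrt_mul hV.det_pos.le, div_div, div_mul_eq_mul_div,
    ← Real.exp_add]
  congr 2
  simp only [invForm_add_left, invForm_add_right, invForm_smul_left, invForm_smul_right]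
  rw [hV.invForm_comm (z a ω) (noiseSum η z s ω)]
  field_simp
  ring

omit [DecidableEq α] [Fintype ι] in
lemma measurable_ridgeGram_apply [MeasurableSpace Ω] (lam : ℝ) {z : α → Ω → ι → ℝ} {s : Finset α}
    (hz : ∀ i ∈ s, Measurable (z i)) (p q : ι) :
    Measurable fun ω => ridgeGram lam z s ω p q := by
  simp only [ridgeGram, Matrix.add_apply, Matrix.sum_apply, vecMulVec_apply]
  refine measurable_const.add (Finset.measurable_sum _ fun i hi => ?_)
  exact ((measurable_pi_apply p).comp (hz i hi)).mul ((measurable_pi_apply q).comp (hz i hi))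

omit [DecidableEq α] [DecidableEq ι] [Fintype ι] in
lemma measurable_noiseSum [MeasurableSpace Ω] {η : α → Ω → ℝ} {z : α → Ω → ι → ℝ} {s : Finset α}
    (hη : ∀ i ∈ s, Measurable (η i)) (hz : ∀ i ∈ s, Measurable (z i)) :
    Measurable (noiseSum η z s) := by
  refine measurable_pi_iff.2 fun p => ?_
  simp only [noiseSum, Finset.sum_apply, Pi.smul_apply, smul_eq_mul]
  exact Finset.measurable_sum _ fun i hi =>
    (hη i hi).mul ((measurable_pi_apply p).comp (hz i hi))

omit [DecidableEq α] in
lemma measurable_mixtureMartingale [MeasurableSpace Ω] (lam : ℝ) {η : α → Ω → ℝ}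
    {z : α → Ω → ι → ℝ} {s : Finset α}
    (hη : ∀ i ∈ s, Measurable (η i)) (hz : ∀ i ∈ s, Measurable (z i)) :
    Measurable (mixtureMartingale lam η z s) := by
  have hV := measurable_ridgeGram_apply lam hz
  have hE := measurable_noiseSum hη hz
  exact ((measurable_invForm hV hE hE).div_const 2).exp.div (measurable_matrix_det hV).sqrt

end SelfNormalized

/-! ### The supermartingale property and the tail bound. -/

section Supermartingale

variable {ι : Type*} [Fintype ι] [DecidableEq ι] {α Ω : Type*} [LinearOrder α]

theorem lintegral_mixtureMartingale_le {mΩ : MeasurableSpace Ω} {P : Measure Ω}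
    [IsProbabilityMeasure P] {lam : ℝ} (hlam : 0 < lam) {m : α → MeasurableSpace Ω}
    (hm : ∀ i, m i ≤ mΩ) {η : α → Ω → ℝ} {z : α → Ω → ι → ℝ}
    (hz : ∀ i j, i ≤ j → Measurable[m j] (z i)) (hη : ∀ i j, i < j → Measurable[m j] (η i))
    (hηm : ∀ i, Measurable (η i))
    (hint : ∀ i, ∀ γ : ℝ, Integrable (fun ω => Real.exp (γ * η i ω)) P)
    (hsub : ∀ i, ∀ γ : ℝ,
      P[fun ω => Real.exp (γ * η i ω) | m i] ≤ᵐ[P] fun _ => Real.exp (γ ^ 2 / 2))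
    (s : Finset α) :
    ∫⁻ ω, ENNReal.ofReal (mixtureMartingale lam η z s ω) ∂P ≤
      ENNReal.ofReal (√(lam • (1 : Matrix ι ι ℝ)).det)⁻¹ := by
  -- Adding the latest index makes everything except its own noise measurable for `m a`.
  refine Finset.induction_on_max s ?_ fun a s has ih => ?_
  · simp [mixtureMartingale, ridgeGram, noiseSum, invForm]
  · refine le_trans ?_ ih
    have ha : a ∉ s := fun h => lt_irrefl _ (has a h)
    let A : Ω → ℝ := fun ω => invForm (ridgeGram lam z s ω) (z a ω) (z a ω)
    let b : Ω → ℝ := fun ω => invForm (ridgeGram lam z s ω) (noiseSum η z s ω) (z a ω)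
    have hzs : ∀ i ∈ s, Measurable[m a] (z i) := fun i hi => hz i a (has i hi).le
    have hηs : ∀ i ∈ s, Measurable[m a] (η i) := fun i hi => hη i a (has i hi)
    have hVm := @measurable_ridgeGram_apply _ _ _ _ (m a) lam z s hzs
    have hAm : Measurable[m a] A := @measurable_invForm _ _ (m a) _ _ _ hVm _ _
      (hz a a le_rfl) (hz a a le_rfl)
    have hbm : Measurable[m a] b := @measurable_invForm _ _ (m a) _ _ _ hVm _ _
      (@measurable_noiseSum _ _ _ (m a) _ _ _ hηs hzs) (hz a a le_rfl)
    have hFm := @measurable_mixtureMartingale _ _ _ _ _ (m a) lam _ _ _ hηs hzs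
    have hA0 : ∀ ω, 0 ≤ A ω := fun ω => (posDef_ridgeGram hlam z s ω).invForm_self_nonneg _
    -- Integrating out the new noise yields at most `√(1 + A)`, which cancels the denominator of the
    -- frozen factor.
    have key := lintegral_le_of_condSubGaussian (hm a) (hηm a) (hint a) (hsub a)
      (f := fun x => ENNReal.ofReal (mixtureMartingale lam η z s x.1 / √(1 + A x.1)) *
        ENNReal.ofReal (Real.exp ((2 * b x.1 * x.2 + A x.1 * x.2 ^ 2 - b x.1 ^ 2) /
          (2 * (1 + A x.1)))))
      (g := fun ω => ENNReal.ofReal (mixtureMartingale lam η z s ω)) ?_ ?_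
    · refine le_trans (le_of_eq (lintegral_congr fun ω => ?_)) key
      rw [mixtureMartingale_insert hlam η z ha, ENNReal.ofReal_mul]
      have := mixtureMartingale_nonneg lam η z s ω
      positivity
    · let _ := m a
      fun_prop
    · intro ω ρ _ hρ
      dsimp only
      rw [lintegral_const_mul _ (by fun_prop)]
      refine (mul_le_mul_right (hρ.lintegral_exp_quadratic_le (hA0 ω) (b ω)) _).trans_eq ?_
      have h1 : 0 < √(1 + A ω) := Real.sqrt_pos.2 (by linarith [hA0 ω])
      rw [← ENNReal.ofReal_mul (div_nonneg (mixtureMartingale_nonneg lam η z s ω) h1.le),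
        div_mul_cancel₀ _ h1.ne']

/-- The self-normalized tail bound for sums of conditionally sub-Gaussian noise. -/
theorem measure_selfNormalized_gt_le {mΩ : MeasurableSpace Ω} {P : Measure Ω}
    [IsProbabilityMeasure P] {lam : ℝ} (hlam : 0 < lam) {m : α → MeasurableSpace Ω}
    (hm : ∀ i, m i ≤ mΩ) {η : α → Ω → ℝ} {z : α → Ω → ι → ℝ}
    (hz : ∀ i j, i ≤ j → Measurable[m j] (z i)) (hη : ∀ i j, i < j → Measurable[m j] (η i))
    (hηm : ∀ i, Measurable (η i))
    (hint : ∀ i, ∀ γ : ℝ, Integrable (fun ω => Real.exp (γ * η i ω)) P)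
    (hsub : ∀ i, ∀ γ : ℝ,
      P[fun ω => Real.exp (γ * η i ω) | m i] ≤ᵐ[P] fun _ => Real.exp (γ ^ 2 / 2))
    (s : Finset α) {δ : ℝ} (hδ : 0 < δ) :
    P {ω | 2 * Real.log (√(ridgeGram lam z s ω).det * (√(lam • (1 : Matrix ι ι ℝ)).det)⁻¹ / δ) <
      invForm (ridgeGram lam z s ω) (noiseSum η z s ω) (noiseSum η z s ω)} ≤
      ENNReal.ofReal δ := by
  have hd : 0 < √(lam • (1 : Matrix ι ι ℝ)).det :=
    Real.sqrt_pos.2 ((PosDef.one.smul hlam : (lam • (1 : Matrix ι ι ℝ)).PosDef)).det_pos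
  set d := √(lam • (1 : Matrix ι ι ℝ)).det with hd'
  have hle := lintegral_mixtureMartingale_le hlam hm hz hη hηm hint hsub s
  have hFm : Measurable fun ω => ENNReal.ofReal (mixtureMartingale lam η z s ω) :=
    (measurable_mixtureMartingale lam (fun i _ => hηm i)
      fun i _ => (hz i i le_rfl).mono (hm i) le_rfl).ennreal_ofReal
  -- Markov's inequality: the process has mean at most `d⁻¹`, so the level `d⁻¹ / δ` leaves
  -- probability `δ`.
  have hmk := mul_meas_ge_le_lintegral (μ := P) hFm (ENNReal.ofReal (d⁻¹ / δ))
  have hsubset : {ω | 2 * Real.log (√(ridgeGram lam z s ω).det * d⁻¹ / δ) <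
      invForm (ridgeGram lam z s ω) (noiseSum η z s ω) (noiseSum η z s ω)} ⊆
      {ω | ENNReal.ofReal (d⁻¹ / δ) ≤ ENNReal.ofReal (mixtureMartingale lam η z s ω)} := by
    intro ω hω
    refine ENNReal.ofReal_le_ofReal ?_
    have hV : 0 < √(ridgeGram lam z s ω).det :=
      Real.sqrt_pos.2 (posDef_ridgeGram hlam z s ω).det_pos
    have h1 : Real.log (√(ridgeGram lam z s ω).det * d⁻¹ / δ) <
      invForm (ridgeGram lam z s ω) (noiseSum η z s ω) (noiseSum η z s ω) / 2 := by
      replace hω := Set.mem_ofPred_eq ▸ hω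
      linarith
    rw [Real.log_lt_iff_lt_exp (by positivity)] at h1
    rw [mixtureMartingale, le_div_iff₀ hV]
    refine le_trans (le_of_eq ?_) h1.le
    ring
  refine (measure_mono hsubset).trans ?_
  have h2 := hmk.trans hle
  have h3 : (√(lam • (1 : Matrix ι ι ℝ)).det)⁻¹ = d⁻¹ / δ * δ := by
    rw [div_mul_cancel₀ _ hδ.ne']
  replace h2 := h2.trans_eq ((congrArg ENNReal.ofReal h3).trans
    (ENNReal.ofReal_mul (by positivity)))
  refine (ENNReal.mul_le_mul_iff_right ?_ ENNReal.ofReal_ne_top).1 h2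
  simp only [ne_eq, ENNReal.ofReal_eq_zero, not_le]
  positivity

end Supermartingale

/-! ### The value of a matrix game: bounds, continuity, measurability. -/

section GameValue

variable {n₁ n₂ : ℕ}

lemma payoff_eq_sum (M : Matrix (Fin n₁) (Fin n₂) ℝ) (x : Fin n₁ → ℝ) (y : Fin n₂ → ℝ) :
    x ⬝ᵥ M.mulVec y = ∑ a, ∑ b, x a * y b * M a b := by
  simp only [dotProduct, mulVec, Finset.mul_sum]
  exact Finset.sum_congr rfl fun a _ => Finset.sum_congr rfl fun b _ => by ring

lemma sum_mul_le_of_mem_stdSimplex {x : Fin n₁ → ℝ} {y : Fin n₂ → ℝ}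
    (hx : x ∈ stdSimplex ℝ (Fin n₁)) (hy : y ∈ stdSimplex ℝ (Fin n₂))
    {f g : Fin n₁ → Fin n₂ → ℝ} {c : ℝ} (h : ∀ a b, f a b ≤ g a b + c) :
    ∑ a, ∑ b, x a * y b * f a b ≤ ∑ a, ∑ b, x a * y b * g a b + c := by
  have hc : ∑ a, ∑ b, x a * y b * c = c := by
    simp_rw [← Finset.sum_mul, ← Finset.mul_sum, hy.2, mul_one, hx.2, one_mul]
  rw [← hc, ← Finset.sum_add_distrib]
  simp_rw [← Finset.sum_add_distrib]
  refine Finset.sum_le_sum fun a _ => Finset.sum_le_sum fun b _ => ?_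
  rw [← mul_add]
  exact mul_le_mul_of_nonneg_left (h a b) (mul_nonneg (hx.1 a) (hy.1 b))

lemma payoff_le_payoff_add {x : Fin n₁ → ℝ} {y : Fin n₂ → ℝ}
    (hx : x ∈ stdSimplex ℝ (Fin n₁)) (hy : y ∈ stdSimplex ℝ (Fin n₂))
    {M M' : Matrix (Fin n₁) (Fin n₂) ℝ} {c : ℝ} (h : ∀ a b, M a b ≤ M' a b + c) :
    x ⬝ᵥ M.mulVec y ≤ x ⬝ᵥ M'.mulVec y + c := by
  rw [payoff_eq_sum, payoff_eq_sum]
  exact sum_mul_le_of_mem_stdSimplex hx hy h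

lemma exists_abs_payoff_le (M : Matrix (Fin n₁) (Fin n₂) ℝ) :
    ∃ c, ∀ x ∈ stdSimplex ℝ (Fin n₁), ∀ y ∈ stdSimplex ℝ (Fin n₂), |x ⬝ᵥ M.mulVec y| ≤ c := by
  refine ⟨∑ a, ∑ b, |M a b|, fun x hx y hy => ?_⟩
  have hb : ∀ a b, |M a b| ≤ ∑ a, ∑ b, |M a b| := fun a b =>
    (Finset.single_le_sum (f := fun b => |M a b|) (fun _ _ => abs_nonneg _)
      (Finset.mem_univ b)).trans (Finset.single_le_sum (f := fun a => ∑ b, |M a b|)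
        (fun _ _ => Finset.sum_nonneg fun _ _ => abs_nonneg _) (Finset.mem_univ a))
  have h0 : x ⬝ᵥ (0 : Matrix (Fin n₁) (Fin n₂) ℝ).mulVec y = 0 := by simp
  refine abs_le.2 ⟨?_, ?_⟩
  · have := payoff_le_payoff_add hx hy (M := 0) (M' := M) (c := ∑ a, ∑ b, |M a b|)
      fun a b => by simpa using by linarith [neg_abs_le (M a b), hb a b]
    linarith
  · have := payoff_le_payoff_add hx hy (M := M) (M' := 0) (c := ∑ a, ∑ b, |M a b|)
      fun a b => by simpa using (le_abs_self _).trans (hb a b)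
    linarith

lemma iInf_payoff_le (M : Matrix (Fin n₁) (Fin n₂) ℝ) {x : Fin n₁ → ℝ} {y : Fin n₂ → ℝ}
    (hx : x ∈ stdSimplex ℝ (Fin n₁)) (hy : y ∈ stdSimplex ℝ (Fin n₂)) :
    (⨅ y : stdSimplex ℝ (Fin n₂), x ⬝ᵥ M.mulVec y.1) ≤ x ⬝ᵥ M.mulVec y := by
  obtain ⟨c, hc⟩ := exists_abs_payoff_le M
  refine ciInf_le (f := fun y : stdSimplex ℝ (Fin n₂) => x ⬝ᵥ M.mulVec y.1) ⟨-c, ?_⟩ ⟨y, hy⟩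
  rintro _ ⟨y', rfl⟩
  exact (abs_le.1 (hc x hx y'.1 y'.2)).1

variable [Nonempty (Fin n₁)]

lemma gameValue_le_of_forall {M : Matrix (Fin n₁) (Fin n₂) ℝ} {y : Fin n₂ → ℝ}
    (hy : y ∈ stdSimplex ℝ (Fin n₂)) {c : ℝ}
    (h : ∀ x ∈ stdSimplex ℝ (Fin n₁), x ⬝ᵥ M.mulVec y ≤ c) : gameValue M ≤ c :=
  ciSup_le fun x => (iInf_payoff_le M x.2 hy).trans (h x.1 x.2)

lemma IsMaximin.gameValue_le {M : Matrix (Fin n₁) (Fin n₂) ℝ} {x : Fin n₁ → ℝ}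
    (hx : IsMaximin M x) {y : Fin n₂ → ℝ} (hy : y ∈ stdSimplex ℝ (Fin n₂)) :
    gameValue M ≤ x ⬝ᵥ M.mulVec y :=
  ciSup_le fun x' => (hx.2 x'.1 x'.2).trans (iInf_payoff_le M hx.1 hy)

variable [Nonempty (Fin n₂)]

lemma gameValue_le_gameValue_add {M M' : Matrix (Fin n₁) (Fin n₂) ℝ} {c : ℝ}
    (h : ∀ a b, M a b ≤ M' a b + c) : gameValue M ≤ gameValue M' + c := by
  refine ciSup_le fun x => ?_
  obtain ⟨d, hd⟩ := exists_abs_payoff_le M'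
  have h1 : (⨅ y : stdSimplex ℝ (Fin n₂), x.1 ⬝ᵥ M.mulVec y.1) - c ≤
      ⨅ y : stdSimplex ℝ (Fin n₂), x.1 ⬝ᵥ M'.mulVec y.1 := by
    refine le_ciInf fun y => ?_
    linarith [iInf_payoff_le M x.2 y.2, payoff_le_payoff_add x.2 y.2 h]
  have h2 : (⨅ y : stdSimplex ℝ (Fin n₂), x.1 ⬝ᵥ M'.mulVec y.1) ≤ gameValue M' := by
    refine le_ciSup (f := fun x : stdSimplex ℝ (Fin n₁) =>
      ⨅ y : stdSimplex ℝ (Fin n₂), x.1 ⬝ᵥ M'.mulVec y.1) ⟨d, ?_⟩ x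
    rintro _ ⟨x', rfl⟩
    obtain ⟨y⟩ := (inferInstance : Nonempty (stdSimplex ℝ (Fin n₂)))
    exact (iInf_payoff_le M' x'.2 y.2).trans (abs_le.1 (hd _ x'.2 _ y.2)).2
  linarith

lemma gameValue_zero : gameValue (0 : Matrix (Fin n₁) (Fin n₂) ℝ) = 0 := by
  simp [gameValue]

lemma abs_gameValue_le {M : Matrix (Fin n₁) (Fin n₂) ℝ} {c : ℝ} (h : ∀ a b, |M a b| ≤ c) :
    |gameValue M| ≤ c := by
  have h0 := gameValue_zero (n₁ := n₁) (n₂ := n₂)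
  refine abs_le.2 ⟨?_, ?_⟩
  · have := gameValue_le_gameValue_add (M := 0) (M' := M) (c := c)
      fun a b => by simpa using by linarith [(abs_le.1 (h a b)).1]
    linarith
  · have := gameValue_le_gameValue_add (M := M) (M' := 0) (c := c)
      fun a b => by simpa using (abs_le.1 (h a b)).2
    linarith

/-- Entrywise comparison makes the value `1`-Lipschitz. Continuity then gives measurability, which
is not immediate for a supremum over uncountably many strategies. -/
lemma continuous_gameValue :
    Continuous fun f : Fin n₁ → Fin n₂ → ℝ => gameValue (Matrix.of f) := by
  refine LipschitzWith.continuous (K := 1) (LipschitzWith.of_le_add fun f g => ?_)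
  refine gameValue_le_gameValue_add fun a b => ?_
  have h1 : dist (f a b) (g a b) ≤ dist f g :=
    (dist_le_pi_dist (f a) (g a) b).trans (dist_le_pi_dist f g a)
  rw [Real.dist_eq] at h1
  simp only [of_apply]
  linarith [le_abs_self (f a b - g a b)]

lemma measurable_gameValue {Ω : Type*} [MeasurableSpace Ω]
    {M : Ω → Matrix (Fin n₁) (Fin n₂) ℝ} (hM : ∀ a b, Measurable fun ω => M ω a b) :
    Measurable fun ω => gameValue (M ω) :=
  continuous_gameValue.measurable.comp
    (measurable_pi_iff.2 fun a => measurable_pi_iff.2 fun b => hM a b)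

end GameValue

lemma measurable_apply_of_countable {Ω I β : Type*} [MeasurableSpace Ω] [MeasurableSpace β]
    [MeasurableSpace I] [Countable I] [MeasurableSingletonClass I] {f : I → Ω → β} {g : Ω → I}
    (hf : ∀ i, Measurable (f i)) (hg : Measurable g) : Measurable fun ω => f (g ω) ω :=
  (measurable_from_prod_countable_right (f := fun p : I × Ω => f p.1 p.2) hf).comp
    (hg.prodMk measurable_id)

/-! ### The interaction as a linear regression model. -/

namespace GameProcess

variable {Ω : Type*} {S K T n₁ n₂ : ℕ}

lemma game_apply (G : GameProcess Ω S K T n₁ n₂) (k : Fin K) (ω : Ω) (a : Fin n₁) (b : Fin n₂) :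
    G.game k ω a b = G.param ω ⬝ᵥ fun s => G.expert k s ω a b := by
  simp [game, mixGame, dotProduct, Matrix.sum_apply]

lemma reward_eq (G : GameProcess Ω S K T n₁ n₂) (k : Fin K) (t : Fin T) (ω : Ω) :
    G.reward k t ω = G.feature k t ω ⬝ᵥ G.param ω + G.noise k t ω := by
  rw [reward, game_apply, dotProduct_comm]; rfl

/-- The rounds of the first `m` episodes. -/
def pastRounds (K T m : ℕ) : Finset (Fin K ×ₗ Fin T) :=
  Finset.univ.filter fun i => ((ofLex i).1 : ℕ) < m

lemma sum_pastRounds {E : Type*} [AddCommMonoid E] (m : ℕ) (f : Fin K → Fin T → E) :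
    ∑ i ∈ pastRounds K T m, f (ofLex i).1 (ofLex i).2 =
      ∑ k ∈ Finset.univ.filter (fun k : Fin K => k.val < m), ∑ t : Fin T, f k t := by
  rw [← Finset.sum_product']
  refine Finset.sum_bij (fun i _ => ofLex i) (fun i hi => ?_) (fun i _ j _ h => ?_)
    (fun p hp => ?_) fun i _ => rfl
  · simpa [pastRounds] using hi
  · exact ofLex.injective h
  · exact ⟨toLex p, by simpa [pastRounds] using hp, rfl⟩

/-- The features indexed by the lexicographically ordered rounds. -/
def lexFeature (G : GameProcess Ω S K T n₁ n₂) (i : Fin K ×ₗ Fin T) : Ω → Fin S → ℝ :=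
  G.feature (ofLex i).1 (ofLex i).2

/-- The noise indexed by the lexicographically ordered rounds. -/
def lexNoise (G : GameProcess Ω S K T n₁ n₂) (i : Fin K ×ₗ Fin T) : Ω → ℝ :=
  G.noise (ofLex i).1 (ofLex i).2

lemma gram_eq_ridgeGram (G : GameProcess Ω S K T n₁ n₂) (lam : ℝ) (m : ℕ) (ω : Ω) :
    G.gram lam m ω = ridgeGram lam G.lexFeature (pastRounds K T m) ω := by
  rw [gram, ridgeGram, ← sum_pastRounds]; rfl

lemma posDef_gram (G : GameProcess Ω S K T n₁ n₂) {lam : ℝ} (hlam : 0 < lam) (m : ℕ) (ω : Ω) :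
    (G.gram lam m ω).PosDef := by
  rw [gram_eq_ridgeGram]; exact posDef_ridgeGram hlam _ _ _

lemma response_eq (G : GameProcess Ω S K T n₁ n₂) (m : ℕ) (ω : Ω) :
    G.response m ω =
      (∑ i ∈ pastRounds K T m, vecMulVec (G.lexFeature i ω) (G.lexFeature i ω)) *ᵥ G.param ω +
        noiseSum G.lexNoise G.lexFeature (pastRounds K T m) ω := by
  rw [response, ← sum_pastRounds m fun k t => G.reward k t ω • G.feature k t ω, noiseSum,
    Matrix.sum_mulVec, ← Finset.sum_add_distrib]
  refine Finset.sum_congr rfl fun i _ => ?_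
  rw [reward_eq, add_smul, vecMulVec_mulVec, op_smul_eq_smul]
  rfl

lemma dotProduct_gram_ge (G : GameProcess Ω S K T n₁ n₂) (lam : ℝ) (m : ℕ) (ω : Ω)
    (x : Fin S → ℝ) : lam * (x ⬝ᵥ x) ≤ x ⬝ᵥ (G.gram lam m ω) *ᵥ x := by
  have h : ∀ z : Fin S → ℝ, x ⬝ᵥ (vecMulVec z z) *ᵥ x = (z ⬝ᵥ x) * (z ⬝ᵥ x) := by
    intro z
    rw [vecMulVec_mulVec, dotProduct_comm]
    simp [smul_dotProduct]
  rw [gram_eq_ridgeGram, ridgeGram, add_mulVec, dotProduct_add, Matrix.sum_mulVec,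
    dotProduct_sum, smul_mulVec, one_mulVec, dotProduct_smul, smul_eq_mul]
  refine le_add_of_nonneg_right (Finset.sum_nonneg fun i _ => ?_)
  rw [h]
  exact mul_self_nonneg _

lemma param_mem_confSet (G : GameProcess Ω S K T n₁ n₂) {lam B δ : ℝ} (hlam : 0 < lam)
    (hB : 0 ≤ B) (m : ℕ) {ω : Ω} (hθ : G.param ω ∈ paramBall S B)
    (h : invForm (G.gram lam m ω) (noiseSum G.lexNoise G.lexFeature (pastRounds K T m) ω)
        (noiseSum G.lexNoise G.lexFeature (pastRounds K T m) ω) ≤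
      2 * Real.log (√(G.gram lam m ω).det *
        (√(lam • (1 : Matrix (Fin S) (Fin S) ℝ)).det)⁻¹ / δ)) :
    G.param ω ∈ G.confSet lam B δ m ω := by
  have h1 := (G.posDef_gram hlam m ω).sqrt_ridge_error_le hlam
    (G.gram_eq_ridgeGram lam m ω) (G.dotProduct_gram_ge lam m ω) (G.param ω)
    (noiseSum G.lexNoise G.lexFeature (pastRounds K T m) ω) hB hθ
  rw [← G.response_eq] at h1
  refine h1.trans ?_
  unfold radius
  gcongr

end GameProcess

/-! ### What is known at each round. -/

namespace GameProcess

variable {Ω : Type*} {S K T n₁ n₂ : ℕ}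

section Filtration

variable (G : GameProcess Ω S K T n₁ n₂)

lemma measurable_info_expert {k k' : Fin K} (h : k' ≤ k) (t : ℕ) (s : Fin S) (a : Fin n₁)
    (b : Fin n₂) : Measurable[G.info k t] fun ω => G.expert k' s ω a b := by
  have h1 : (MeasurableSpace.comap (fun ω s a b => G.expert k' s ω a b)
      (inferInstanceAs (MeasurableSpace (Fin S → Fin n₁ → Fin n₂ → ℝ)))) ≤ G.info k t :=
    le_sup_of_le_left (le_sup_of_le_right (le_iSup₂_of_le k' h le_rfl))
  have h2 : Measurable fun f : Fin S → Fin n₁ → Fin n₂ → ℝ => f s a b := by fun_prop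
  exact (h2.comp (comap_measurable _)).mono h1 le_rfl

lemma measurable_info_param (k : Fin K) (t : ℕ) : Measurable[G.info k t] G.param :=
  (comap_measurable _).mono le_sup_right le_rfl

lemma measurable_info_past {k k' : Fin K} {t : ℕ} {t' : Fin T}
    (h : k' < k ∨ (k' = k ∧ (t' : ℕ) < t)) :
    Measurable[G.info k t] fun ω => (G.row k' t' ω, G.col k' t' ω, G.reward k' t' ω) :=
  (comap_measurable _).mono
    (le_sup_of_le_left (le_sup_of_le_left (le_iSup₂_of_le k' t' (le_iSup_of_le h le_rfl)))) le_rfl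

lemma measurable_feature_of [MeasurableSpace Ω] {k : Fin K} {t : Fin T}
    (hexp : ∀ s a b, Measurable fun ω => G.expert k s ω a b)
    (hact : Measurable fun ω => (G.row k t ω, G.col k t ω)) : Measurable (G.feature k t) :=
  measurable_pi_iff.2 fun s => measurable_apply_of_countable
    (f := fun (p : Fin n₁ × Fin n₂) ω => G.expert k s ω p.1 p.2) (fun p => hexp s p.1 p.2) hact

/-- Only payoffs are recorded in the history; the noise is recovered from them by subtracting
`feature ⬝ param`, hence the role of `θ*` in `info`. -/
lemma measurable_noise_of [MeasurableSpace Ω] {k : Fin K} {t : Fin T}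
    (hparam : Measurable G.param) (hfeat : Measurable (G.feature k t))
    (hrew : Measurable (G.reward k t)) : Measurable (G.noise k t) := by
  have h : G.noise k t = fun ω => G.reward k t ω - G.feature k t ω ⬝ᵥ G.param ω := by
    funext ω; rw [reward_eq]; ring
  rw [h]
  exact hrew.sub (measurable_dotProduct hfeat hparam)

lemma measurable_info_feature {k k' : Fin K} {t : ℕ} {t' : Fin T}
    (h : k' < k ∨ (k' = k ∧ (t' : ℕ) < t)) : Measurable[G.info k t] (G.feature k' t') := by
  have hk : k' ≤ k := h.elim le_of_lt fun h => h.1.le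
  have hp := G.measurable_info_past h
  let _ := G.info k t
  exact G.measurable_feature_of (fun s a b => G.measurable_info_expert hk t s a b)
    (by exact hp.fst.prodMk hp.snd.fst)

lemma measurable_info_noise {k k' : Fin K} {t : ℕ} {t' : Fin T}
    (h : k' < k ∨ (k' = k ∧ (t' : ℕ) < t)) : Measurable[G.info k t] (G.noise k' t') := by
  have hp := G.measurable_info_past h
  have hf := G.measurable_info_feature h
  have hθ := G.measurable_info_param k t
  let _ := G.info k t
  exact G.measurable_noise_of hθ hf hp.snd.snd

lemma measurable_infoActions_feature (k : Fin K) (t : Fin T) :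
    Measurable[G.infoActions k t] (G.feature k t) := by
  have hi : G.info k t ≤ G.infoActions k t := le_sup_left
  have ha : Measurable[G.infoActions k t] fun ω => (G.row k t ω, G.col k t ω) :=
    (comap_measurable _).mono le_sup_right le_rfl
  let _ := G.infoActions k t
  exact G.measurable_feature_of
    (fun s a b => (G.measurable_info_expert le_rfl t s a b).mono hi le_rfl) ha

lemma measurable_infoActions_lexFeature {i j : Fin K ×ₗ Fin T} (h : i ≤ j) :
    Measurable[G.infoActions (ofLex j).1 (ofLex j).2] (G.lexFeature i) := by
  rcases h.eq_or_lt with rfl | h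
  · exact G.measurable_infoActions_feature _ _
  · exact (G.measurable_info_feature (Prod.Lex.lt_iff.1 h)).mono le_sup_left le_rfl

lemma measurable_infoActions_lexNoise {i j : Fin K ×ₗ Fin T} (h : i < j) :
    Measurable[G.infoActions (ofLex j).1 (ofLex j).2] (G.lexNoise i) :=
  (G.measurable_info_noise (Prod.Lex.lt_iff.1 h)).mono le_sup_left le_rfl

lemma measurable_info_gram (lam : ℝ) (k : Fin K) (t : ℕ) (p q : Fin S) :
    Measurable[G.info k t] fun ω => G.gram lam k ω p q := by
  have h : ∀ i ∈ pastRounds K T k, Measurable[G.info k t] (G.lexFeature i) := fun i hi =>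
    G.measurable_info_feature (Or.inl (by simpa [pastRounds] using hi))
  let _ := G.info k t
  simp only [gram_eq_ridgeGram]
  exact measurable_ridgeGram_apply lam h p q

end Filtration

end GameProcess

/-! ### Confidence ellipsoids, and averaging over the actions. -/

namespace IsInteraction

variable {Ω : Type*} [mΩ : MeasurableSpace Ω] {S K T n₁ n₂ : ℕ} {G : GameProcess Ω S K T n₁ n₂}
  {P : Measure Ω}

lemma measurable_feature (hG : IsInteraction G P) (k : Fin K) (t : Fin T) :
    Measurable (G.feature k t) :=
  G.measurable_feature_of (hG.measurable_expert k)
    ((hG.measurable_row k t).prodMk (hG.measurable_col k t))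

lemma measurable_reward (hG : IsInteraction G P) (k : Fin K) (t : Fin T) :
    Measurable (G.reward k t) := by
  have h : G.reward k t = fun ω => G.feature k t ω ⬝ᵥ G.param ω + G.noise k t ω :=
    funext fun ω => G.reward_eq k t ω
  rw [h]
  exact (measurable_dotProduct (hG.measurable_feature k t) hG.measurable_param).add
    (hG.measurable_noise k t)

lemma info_le (hG : IsInteraction G P) (k : Fin K) (t : ℕ) : G.info k t ≤ mΩ := by
  refine sup_le (sup_le ?_ ?_) hG.measurable_param.comap_le
  · refine iSup_le fun k' => iSup_le fun t' => iSup_le fun _ => Measurable.comap_le ?_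
    exact (hG.measurable_row k' t').prodMk
      ((hG.measurable_col k' t').prodMk (hG.measurable_reward k' t'))
  · refine iSup₂_le fun k' _ => Measurable.comap_le ?_
    exact measurable_pi_iff.2 fun s => measurable_pi_iff.2 fun a => measurable_pi_iff.2 fun b =>
      hG.measurable_expert k' s a b

lemma infoActions_le (hG : IsInteraction G P) (k : Fin K) (t : Fin T) :
    G.infoActions k t ≤ mΩ :=
  sup_le (hG.info_le k t)
    ((hG.measurable_row k t).prodMk (hG.measurable_col k t)).comap_le

/-- The confidence ellipsoid of a fixed episode fails with probability at most `δ`. -/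
lemma measure_confidence_fails_le [IsProbabilityMeasure P] (hG : IsInteraction G P) {lam : ℝ}
    (hlam : 0 < lam) (m : ℕ) {δ : ℝ} (hδ : 0 < δ) :
    P {ω | 2 * Real.log (√(G.gram lam m ω).det *
        (√(lam • (1 : Matrix (Fin S) (Fin S) ℝ)).det)⁻¹ / δ) <
      invForm (G.gram lam m ω)
        (noiseSum G.lexNoise G.lexFeature (GameProcess.pastRounds K T m) ω)
        (noiseSum G.lexNoise G.lexFeature (GameProcess.pastRounds K T m) ω)} ≤
      ENNReal.ofReal δ := by
  simp only [GameProcess.gram_eq_ridgeGram]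
  exact measure_selfNormalized_gt_le hlam
    (m := fun i : Fin K ×ₗ Fin T => G.infoActions (ofLex i).1 (ofLex i).2)
    (fun i => hG.infoActions_le _ _) (fun i j h => G.measurable_infoActions_lexFeature h)
    (fun i j h => G.measurable_infoActions_lexNoise h) (fun i => hG.measurable_noise _ _)
    (fun i => hG.integrable_exp_noise _ _) (fun i => hG.noise_subGaussian _ _) _ hδ

lemma measurableSet_confidence_fails (hG : IsInteraction G P) (lam : ℝ) (m : ℕ) (δ : ℝ) :
    MeasurableSet {ω | 2 * Real.log (√(G.gram lam m ω).det *
        (√(lam • (1 : Matrix (Fin S) (Fin S) ℝ)).det)⁻¹ / δ) <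
      invForm (G.gram lam m ω)
        (noiseSum G.lexNoise G.lexFeature (GameProcess.pastRounds K T m) ω)
        (noiseSum G.lexNoise G.lexFeature (GameProcess.pastRounds K T m) ω)} := by
  have hV : ∀ p q, Measurable fun ω => G.gram lam m ω p q := by
    simp only [GameProcess.gram_eq_ridgeGram]
    exact measurable_ridgeGram_apply lam fun i _ => hG.measurable_feature _ _
  have hE : Measurable (noiseSum G.lexNoise G.lexFeature (GameProcess.pastRounds K T m)) :=
    measurable_noiseSum (fun i _ => hG.measurable_noise _ _) fun i _ => hG.measurable_feature _ _
  exact measurableSet_lt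
    ((((measurable_matrix_det hV).sqrt.mul_const _).div_const _).log.const_mul 2)
    (measurable_invForm hV hE hE)

/-- The expectation of a function of the actions of a round which is known at that round, in terms
of the mixed strategies. -/
lemma integral_comp_actions [IsProbabilityMeasure P] (hG : IsInteraction G P) (k : Fin K)
    (t : Fin T) {h : Fin n₁ → Fin n₂ → Ω → ℝ} (hm : ∀ a b, Measurable[G.info k t] (h a b))
    (hi : ∀ a b, Integrable (h a b) P) :
    Integrable (fun ω => ∑ a, ∑ b, G.rowStrat k ω a * G.colStrat k t ω b * h a b ω) P ∧
      ∫ ω, ∑ a, ∑ b, G.rowStrat k ω a * G.colStrat k t ω b * h a b ω ∂P =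
        ∫ ω, h (G.row k t ω) (G.col k t ω) ω ∂P := by
  have hle := hG.info_le k t
  let I : Fin n₁ → Fin n₂ → Ω → ℝ := fun a b =>
    Set.indicator {ω | G.row k t ω = a ∧ G.col k t ω = b} (fun _ => (1 : ℝ))
  have hset : ∀ a b, MeasurableSet {ω | G.row k t ω = a ∧ G.col k t ω = b} := fun a b =>
    (hG.measurable_row k t (measurableSet_singleton a)).inter
      (hG.measurable_col k t (measurableSet_singleton b))
  have hI : ∀ a b, Integrable (I a b) P := fun a b => (integrable_const 1).indicator (hset a b)
  have hIh : ∀ a b, h a b * I a b =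
      Set.indicator {ω | G.row k t ω = a ∧ G.col k t ω = b} (h a b) := by
    intro a b
    funext ω
    by_cases hω : G.row k t ω = a ∧ G.col k t ω = b <;> simp [I, hω]
  have hhI : ∀ a b, Integrable (h a b * I a b) P := fun a b => by
    rw [hIh]; exact (hi a b).indicator (hset a b)
  have hce : ∀ a b, P[h a b * I a b | G.info k t] =ᵐ[P]
      fun ω => G.rowStrat k ω a * G.colStrat k t ω b * h a b ω := by
    intro a b
    filter_upwards [condExp_mul_of_stronglyMeasurable_left (hm a b).stronglyMeasurable (hhI a b)
      (hI a b), hG.sampling k t a b] with ω h1 h2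
    rw [h1, Pi.mul_apply, h2, mul_comm]
  -- No measurability of `colStrat` is assumed: integrability is inherited from the conditional
  -- expectation with which the product agrees almost surely.
  have hint : ∀ a b, Integrable
      (fun ω => G.rowStrat k ω a * G.colStrat k t ω b * h a b ω) P := fun a b =>
    integrable_condExp.congr (hce a b)
  have heq : ∀ a b, ∫ ω, G.rowStrat k ω a * G.colStrat k t ω b * h a b ω ∂P =
      ∫ ω, (h a b * I a b) ω ∂P := fun a b => by
    rw [← integral_congr_ae (hce a b), integral_condExp hle]
  refine ⟨integrable_finsetSum _ fun a _ => integrable_finsetSum _ fun b _ => hint a b, ?_⟩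
  rw [integral_finsetSum _ fun a _ => integrable_finsetSum _ fun b _ => hint a b]
  simp_rw [integral_finsetSum _ fun b _ => hint _ b, heq]
  simp_rw [← integral_finsetSum _ fun b _ => hhI _ b]
  rw [← integral_finsetSum _ fun a _ => integrable_finsetSum _ fun b _ => hhI a b]
  refine integral_congr_ae (ae_of_all _ fun ω => ?_)
  dsimp only
  rw [Finset.sum_eq_single (G.row k t ω), Finset.sum_eq_single (G.col k t ω)]
  · simp [I]
  · intro b _ hb; simp [I, hb.symm]
  · simp
  · intro a _ ha; simp [I, ha.symm]
  · simp

end IsInteraction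

/-! ### Widths and the elliptical potential. -/

namespace GameProcess

variable {Ω : Type*} {S K T n₁ n₂ : ℕ} (G : GameProcess Ω S K T n₁ n₂)

/-- The features of the pair of actions `(a, b)` in episode `k`. -/
def entry (k : Fin K) (a : Fin n₁) (b : Fin n₂) (ω : Ω) : Fin S → ℝ :=
  fun s => G.expert k s ω a b

/-- The width of the confidence ellipsoid of episode `k` in the direction `z`. -/
def width (lam B δ : ℝ) (k : ℕ) (z : Fin S → ℝ) (ω : Ω) : ℝ :=
  2 * (√(G.radius lam B δ k ω) * √(invForm (G.gram lam k ω) z z))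

lemma width_nonneg (lam B δ : ℝ) (k : ℕ) (z : Fin S → ℝ) (ω : Ω) :
    0 ≤ G.width lam B δ k z ω := by unfold width; positivity

lemma abs_dotProduct_le_of_mem_confSet {lam B δ : ℝ} (hlam : 0 < lam) {k : ℕ} {ω : Ω}
    {θ : Fin S → ℝ} (hθ : θ ∈ G.confSet lam B δ k ω) (z : Fin S → ℝ) :
    |(θ - G.estimate lam k ω) ⬝ᵥ z| ≤
      √(G.radius lam B δ k ω) * √(invForm (G.gram lam k ω) z z) := by
  have hV := G.posDef_gram hlam k ω
  have hr : 0 ≤ G.radius lam B δ k ω := sq_nonneg _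
  rw [← Real.sqrt_mul hr]
  refine Real.abs_le_sqrt ((hV.dotProduct_sq_le _ z).trans ?_)
  exact mul_le_mul_of_nonneg_right hθ (hV.invForm_self_nonneg z)

lemma dotProduct_le_add_width {lam B δ : ℝ} (hlam : 0 < lam) {k : ℕ} {ω : Ω}
    {θ θ' : Fin S → ℝ} (hθ : θ ∈ G.confSet lam B δ k ω) (hθ' : θ' ∈ G.confSet lam B δ k ω)
    (z : Fin S → ℝ) : θ' ⬝ᵥ z ≤ θ ⬝ᵥ z + G.width lam B δ k z ω := by
  have h1 := abs_le.1 (G.abs_dotProduct_le_of_mem_confSet hlam hθ z)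
  have h2 := abs_le.1 (G.abs_dotProduct_le_of_mem_confSet hlam hθ' z)
  rw [sub_dotProduct] at h1 h2
  unfold width
  linarith [h1.1, h2.2]

/-- The event that the noise accumulated before episode `m` violates the self-normalized bound. -/
def noiseFails (lam δ : ℝ) (m : ℕ) : Set Ω :=
  {ω | 2 * Real.log (√(G.gram lam m ω).det *
      (√(lam • (1 : Matrix (Fin S) (Fin S) ℝ)).det)⁻¹ / δ) <
    invForm (G.gram lam m ω) (noiseSum G.lexNoise G.lexFeature (pastRounds K T m) ω)
      (noiseSum G.lexNoise G.lexFeature (pastRounds K T m) ω)}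

/-- Episodes count from zero, so `gram lam k` is the matrix available when episode `k` begins. -/
lemma gram_succ (lam : ℝ) (k : Fin K) (ω : Ω) :
    G.gram lam (k + 1) ω = G.gram lam k ω +
      ∑ t : Fin T, vecMulVec (G.feature k t ω) (G.feature k t ω) := by
  have h : Finset.univ.filter (fun k' : Fin K => k'.val < (k : ℕ) + 1) =
      insert k (Finset.univ.filter fun k' : Fin K => k'.val < (k : ℕ)) := by
    ext k'
    simp only [Finset.mem_filter, Finset.mem_univ, true_and, Finset.mem_insert, Fin.ext_iff]
    omega
  rw [gram, gram, h, Finset.sum_insert (by simp), add_assoc]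
  congr 1
  exact add_comm _ _

lemma gram_zero (lam : ℝ) (ω : Ω) : G.gram lam 0 ω = lam • 1 := by simp [gram]

lemma log_det_smul_one (lam : ℝ) :
    Real.log (lam • (1 : Matrix (Fin S) (Fin S) ℝ)).det = S * Real.log lam := by
  rw [det_smul, det_one, mul_one, Real.log_pow, Fintype.card_fin]

/-- The trace is at most `λ S` plus `S` for each of the `KT` rounds. -/
lemma log_det_gram_le {lam : ℝ} (hlam : 0 < lam) (hS : 1 ≤ S) (m : ℕ) {ω : Ω}
    (hz : ∀ k t, G.feature k t ω ⬝ᵥ G.feature k t ω ≤ S) :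
    Real.log (G.gram lam m ω).det - S * Real.log lam ≤
      S * Real.log (S * (lam + K * T) / lam) := by
  have hV := G.posDef_gram hlam m ω
  have hS' : (0 : ℝ) < S := by exact_mod_cast hS
  have htr : (G.gram lam m ω).trace ≤ S * (lam + K * T) := by
    have h1 : ∀ k : Fin K, ∑ t : Fin T, G.feature k t ω ⬝ᵥ G.feature k t ω ≤ T * S := fun k =>
      (Finset.sum_le_card_nsmul _ _ _ fun t _ => hz k t).trans_eq (by simp)
    have h0 : ∀ k : Fin K, 0 ≤ ∑ t : Fin T, G.feature k t ω ⬝ᵥ G.feature k t ω := fun k =>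
      Finset.sum_nonneg fun t _ => by simpa using dotProduct_star_self_nonneg (G.feature k t ω)
    have h2 : ∑ k : Fin K, ∑ t : Fin T, G.feature k t ω ⬝ᵥ G.feature k t ω ≤ K * (T * S) :=
      (Finset.sum_le_card_nsmul _ _ _ fun k _ => h1 k).trans_eq (by simp)
    have h3 : ∑ k ∈ Finset.univ.filter (fun k : Fin K => k.val < m), ∑ t : Fin T,
        G.feature k t ω ⬝ᵥ G.feature k t ω ≤
        ∑ k : Fin K, ∑ t : Fin T, G.feature k t ω ⬝ᵥ G.feature k t ω :=
      Finset.sum_le_sum_of_subset_of_nonneg (Finset.filter_subset _ _) fun k _ _ => h0 k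
    rw [gram, trace_add, trace_smul, trace_one, trace_sum]
    simp_rw [trace_sum, trace_vecMulVec]
    simp only [Fintype.card_fin, smul_eq_mul]
    nlinarith
  have hpos : 0 ≤ (G.gram lam m ω).trace := hV.posSemidef.trace_nonneg
  have hdet : (G.gram lam m ω).det ≤ (S * (lam + K * T)) ^ S := by
    refine hV.det_le_trace_pow.trans ?_
    rw [Fintype.card_fin]
    gcongr
  have hlog := Real.log_le_log hV.det_pos hdet
  rw [Real.log_pow] at hlog
  rw [Real.log_div (by positivity) hlam.ne', mul_sub]
  linarith

lemma sqrt_radius_le {lam B N : ℝ} (hlam : 0 < lam) (hB : 0 ≤ B) (hN : 0 < N) (hS : 1 ≤ S)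
    (m : ℕ) {ω : Ω} (hz : ∀ k t, G.feature k t ω ⬝ᵥ G.feature k t ω ≤ S) :
    √(G.radius lam B (1 / N) m ω) ≤
      √(S * Real.log (S * (lam + K * T) / lam) + 2 * Real.log N) + √lam * B := by
  have hV := (G.posDef_gram hlam m ω).det_pos
  have h1 : 0 < (lam • (1 : Matrix (Fin S) (Fin S) ℝ)).det := by
    rw [← G.gram_zero lam ω]; exact (G.posDef_gram hlam 0 ω).det_pos
  have hlog : 2 * Real.log (√(G.gram lam m ω).det *
      (√(lam • (1 : Matrix (Fin S) (Fin S) ℝ)).det)⁻¹ / (1 / N)) =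
      Real.log (G.gram lam m ω).det - S * Real.log lam + 2 * Real.log N := by
    have hs1 := Real.sqrt_pos.2 hV
    have hs2 := Real.sqrt_pos.2 h1
    rw [div_div_eq_mul_div, div_one, Real.log_mul (by positivity) hN.ne',
      Real.log_mul hs1.ne' (by positivity), Real.log_inv, Real.log_sqrt hV.le,
      Real.log_sqrt h1.le, log_det_smul_one]
    ring
  rw [radius, Real.sqrt_sq (by positivity), hlog]
  gcongr
  exact G.log_det_gram_le hlam hS m hz

/-- The elliptical potential bound with the Gram matrix updated once per episode. -/
lemma sum_invForm_feature_le {lam κ : ℝ} (hlam : 0 < lam) (hκ : 0 < κ) (hS : 1 ≤ S) {ω : Ω}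
    (hz : ∀ k t, G.feature k t ω ⬝ᵥ G.feature k t ω ≤ S)
    (hdet : ∀ k : Fin K, (G.gram lam (k + 1) ω).det / (G.gram lam k ω).det ≤ κ) :
    ∑ k : Fin K, ∑ t : Fin T, invForm (G.gram lam k ω) (G.feature k t ω) (G.feature k t ω) ≤
      κ * (S * Real.log (S * (lam + K * T) / lam)) := by
  have hep : ∀ k : Fin K,
      ∑ t : Fin T, invForm (G.gram lam k ω) (G.feature k t ω) (G.feature k t ω) ≤
        κ * (Real.log (G.gram lam (k + 1) ω).det - Real.log (G.gram lam k ω).det) := by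
    intro k
    have hV := (G.posDef_gram hlam k ω)
    have hV' := (G.posDef_gram hlam (k + 1) ω).det_pos
    have h1 := det_mul_one_add_sum_invForm_le Finset.univ (fun t => G.feature k t ω) hV
    rw [← G.gram_succ, mul_comm, ← le_div_iff₀ hV.det_pos] at h1
    rw [← Real.log_div hV'.ne' hV.det_pos.ne']
    have hκk := hdet k
    set ρ := (G.gram lam (k + 1) ω).det / (G.gram lam k ω).det with hρ
    have hρ0 : 0 < ρ := div_pos hV' hV.det_pos
    have hlog := Real.one_sub_inv_le_log_of_pos hρ0
    have hX : 0 ≤ ∑ t : Fin T, invForm (G.gram lam k ω) (G.feature k t ω) (G.feature k t ω) :=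
      Finset.sum_nonneg fun t _ => hV.invForm_self_nonneg _
    -- With `X` the sum over the episode, `X ≤ ρ - 1 = ρ (1 - ρ⁻¹) ≤ κ (1 - ρ⁻¹) ≤ κ log ρ`; the
    -- logarithms then telescope over the episodes.
    have h2 : ρ - 1 = ρ * (1 - ρ⁻¹) := by field_simp
    have h3 : 0 ≤ 1 - ρ⁻¹ := by
      have : ρ⁻¹ ≤ 1 := inv_le_one_of_one_le₀ (by linarith)
      linarith
    nlinarith [mul_le_mul_of_nonneg_right hκk h3, mul_le_mul_of_nonneg_left hlog hκ.le]
  have htel : ∑ k : Fin K,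
      (Real.log (G.gram lam (k + 1) ω).det - Real.log (G.gram lam k ω).det) =
      Real.log (G.gram lam K ω).det - S * Real.log lam := by
    rw [Fin.sum_univ_eq_sum_range
      (fun k => Real.log (G.gram lam (k + 1) ω).det - Real.log (G.gram lam k ω).det) K,
      Finset.sum_range_sub (fun k => Real.log (G.gram lam k ω).det), gram_zero, log_det_smul_one]
  refine (Finset.sum_le_sum fun k _ => hep k).trans ?_
  rw [← Finset.mul_sum, htel]
  exact mul_le_mul_of_nonneg_left (G.log_det_gram_le hlam hS K hz) hκ.le

lemma sum_width_feature_le {lam B κ N : ℝ} (hlam : 0 < lam) (hB : 0 ≤ B) (hκ : 0 < κ)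
    (hN : 0 < N) (hS : 1 ≤ S) {ω : Ω}
    (hz : ∀ k t, G.feature k t ω ⬝ᵥ G.feature k t ω ≤ S)
    (hdet : ∀ k : Fin K, (G.gram lam (k + 1) ω).det / (G.gram lam k ω).det ≤ κ) :
    ∑ k : Fin K, ∑ t : Fin T, G.width lam B (1 / N) k (G.feature k t ω) ω ≤
      2 * (√(S * Real.log (S * (lam + K * T) / lam) + 2 * Real.log N) + √lam * B) *
        √((K * T) * (κ * (S * Real.log (S * (lam + K * T) / lam)))) := by
  set R := √(S * Real.log (S * (lam + K * T) / lam) + 2 * Real.log N) + √lam * B with hR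
  have hR0 : 0 ≤ R := by positivity
  have hq := G.sum_invForm_feature_le hlam hκ hS hz hdet
  have h1 : ∑ k : Fin K, ∑ t : Fin T, G.width lam B (1 / N) k (G.feature k t ω) ω ≤
      2 * R * ∑ p : Fin K × Fin T,
        √(invForm (G.gram lam p.1 ω) (G.feature p.1 p.2 ω) (G.feature p.1 p.2 ω)) := by
    rw [← Finset.sum_product', Finset.mul_sum, Finset.univ_product_univ]
    refine Finset.sum_le_sum fun p _ => ?_
    rw [width, mul_assoc]
    have := G.sqrt_radius_le hlam hB hN hS p.1 hz
    gcongr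
  refine h1.trans (mul_le_mul_of_nonneg_left (Real.le_sqrt_of_sq_le ?_) (by positivity))
  -- Cauchy–Schwarz over the `KT` rounds produces the `√(KT)` rate.
  refine (sq_sum_le_card_mul_sum_sq).trans ?_
  have h2 : ∀ p : Fin K × Fin T,
      √(invForm (G.gram lam p.1 ω) (G.feature p.1 p.2 ω) (G.feature p.1 p.2 ω)) ^ 2 =
        invForm (G.gram lam p.1 ω) (G.feature p.1 p.2 ω) (G.feature p.1 p.2 ω) := fun p =>
    Real.sq_sqrt ((G.posDef_gram hlam p.1 ω).invForm_self_nonneg _)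
  simp_rw [h2]
  rw [Fintype.sum_prod_type, Finset.card_univ, Fintype.card_prod, Fintype.card_fin,
    Fintype.card_fin, Nat.cast_mul]
  exact mul_le_mul_of_nonneg_left hq (by positivity)

lemma measurable_info_entry (k : Fin K) (t : ℕ) (a : Fin n₁) (b : Fin n₂) :
    Measurable[G.info k t] (G.entry k a b) := by
  have h := fun s => G.measurable_info_expert (le_refl k) t s a b
  let _ := G.info k t
  exact measurable_pi_iff.2 h

lemma measurable_info_width (lam B δ : ℝ) (k : Fin K) (t : ℕ) (a : Fin n₁) (b : Fin n₂) :
    Measurable[G.info k t] fun ω => G.width lam B δ k (G.entry k a b ω) ω := by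
  have hV := G.measurable_info_gram lam k t
  have he := G.measurable_info_entry k t a b
  let _ := G.info k t
  have h1 := measurable_invForm hV he he
  have h2 := measurable_matrix_det hV
  unfold width radius
  fun_prop

lemma measurable_info_game (k : Fin K) (t : ℕ) (a : Fin n₁) (b : Fin n₂) :
    Measurable[G.info k t] fun ω => G.game k ω a b := by
  have he := G.measurable_info_entry k t a b
  have hp := G.measurable_info_param k t
  let _ := G.info k t
  simp only [G.game_apply]
  exact measurable_dotProduct hp he

end GameProcess

/-! ### The regret of one round. -/

section Regret

variable {Ω : Type*} [mΩ : MeasurableSpace Ω] {S K T n₁ n₂ : ℕ} {G : GameProcess Ω S K T n₁ n₂}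
  {P : Measure Ω}

lemma IsInteraction.entry_dotProduct_self_le (hG : IsInteraction G P) (k : Fin K) (a : Fin n₁)
    (b : Fin n₂) (ω : Ω) : G.entry k a b ω ⬝ᵥ G.entry k a b ω ≤ S := by
  refine (Finset.sum_le_card_nsmul _ _ 1 fun s _ => ?_).trans_eq (by simp)
  have h := hG.expert_mem k s ω a b
  exact mul_le_one₀ h.2 h.1 h.2

lemma IsInteraction.abs_game_le (hG : IsInteraction G P) {B : ℝ} {ω : Ω}
    (hB : 0 ≤ B) (hθ : G.param ω ∈ paramBall S B) (k : Fin K) (a : Fin n₁) (b : Fin n₂) :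
    |G.game k ω a b| ≤ B * √S := by
  rw [G.game_apply]
  have h1 : (G.param ω ⬝ᵥ G.entry k a b ω) ^ 2 ≤
      (G.param ω ⬝ᵥ G.param ω) * (G.entry k a b ω ⬝ᵥ G.entry k a b ω) := by
    simpa using (PosDef.one (n := Fin S) (R := ℝ)).posSemidef.dotProduct_mulVec_sq_le (G.param ω)
      (G.entry k a b ω)
  have h2 : (G.param ω ⬝ᵥ G.entry k a b ω) ^ 2 ≤ B ^ 2 * S :=
    h1.trans (mul_le_mul hθ (hG.entry_dotProduct_self_le k a b ω)
      (by simpa using dotProduct_star_self_nonneg (G.entry k a b ω)) (sq_nonneg B))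
  refine (Real.abs_le_sqrt h2).trans_eq ?_
  rw [Real.sqrt_mul (sq_nonneg B), Real.sqrt_sq hB]

/-- Optimism: outside the failure event, the value of the true game exceeds the expected payoff
of the strategies played by at most the expected width. -/
lemma IsOFULinMat.gameValue_le {lam B δ κ : ℝ} (hlam : 0 < lam) (hB : 0 ≤ B)
    (hG : IsInteraction G P) (hO : IsOFULinMat G P lam B δ) (hball : ParamInBall G P B)
    (hR : IsRegularGame G P lam κ) (k : Fin K) (t : Fin T) :
    ∀ᵐ ω ∂P, gameValue (G.game k ω) ≤
      ∑ a, ∑ b, G.rowStrat k ω a * G.colStrat k t ω b *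
        (G.game k ω a b + G.width lam B δ k (G.entry k a b ω) ω) +
        (G.noiseFails lam δ k).indicator (fun _ => (1 : ℝ)) ω := by
  filter_upwards [hO.optimistic k, hball, hR.gap] with ω hopt hθ hgap
  have hμ := hG.rowStrat_mem k ω
  have hν := hG.colStrat_mem k t ω
  have : Nonempty (Fin n₁) := ⟨G.row k t ω⟩
  -- On failure, the value is at most the best response payoff to the column strategy played, which
  -- exceeds the payoff of `rowStrat` by at most `1`.
  by_cases hω : ω ∈ G.noiseFails lam δ k
  · rw [Set.indicator_of_mem hω]
    refine gameValue_le_of_forall hν fun x hx => ?_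
    have h1 := hgap k _ hν x hx _ hμ
    rw [sub_dotProduct] at h1
    have h2 := sum_mul_le_of_mem_stdSimplex hμ hν (f := fun a b => G.game k ω a b)
      (g := fun a b => G.game k ω a b + G.width lam B δ k (G.entry k a b ω) ω) (c := 0)
      fun a b => by linarith [G.width_nonneg lam B δ k (G.entry k a b ω) ω]
    rw [← payoff_eq_sum] at h2
    linarith
  · rw [Set.indicator_of_notMem hω, add_zero]
    have hmem : G.param ω ∈ G.confSet lam B δ k ω :=
      G.param_mem_confSet hlam hB k hθ (not_lt.1 hω)
    -- True value ≤ optimistic value ≤ optimistic payoff of the strategies played; the last is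
    -- compared with the true payoff entry by entry.
    obtain ⟨θ', hθ', hmax, hmaximin⟩ := hopt ⟨_, hmem, hθ⟩
    refine (hmax _ ⟨hmem, hθ⟩).trans ((hmaximin.gameValue_le hν).trans ?_)
    rw [payoff_eq_sum]
    refine (sum_mul_le_of_mem_stdSimplex hμ hν (c := 0) fun a b => ?_).trans_eq (add_zero _)
    have h := G.dotProduct_le_add_width hlam hmem hθ'.1 (G.entry k a b ω)
    rw [G.game_apply, add_zero]
    refine le_trans (le_of_eq ?_) h
    simp [mixGame, dotProduct, Matrix.sum_apply, GameProcess.entry]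

/-- A crude deterministic bound, which serves only for integrability. -/
lemma IsInteraction.width_le (hG : IsInteraction G P) {lam B N : ℝ} (hlam : 0 < lam)
    (hB : 0 ≤ B) (hN : 0 < N) (hS : 1 ≤ S) (k : Fin K) (a : Fin n₁) (b : Fin n₂) (ω : Ω) :
    G.width lam B (1 / N) k (G.entry k a b ω) ω ≤
      2 * ((√(S * Real.log (S * (lam + K * T) / lam) + 2 * Real.log N) + √lam * B) *
        √(S / lam)) := by
  have h1 := G.sqrt_radius_le hlam hB hN hS k
    (fun k t => hG.entry_dotProduct_self_le k (G.row k t ω) (G.col k t ω) ω)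
  have h2 : invForm (G.gram lam k ω) (G.entry k a b ω) (G.entry k a b ω) ≤ S / lam := by
    rw [le_div_iff₀' hlam]
    exact ((G.posDef_gram hlam k ω).invForm_self_le hlam (G.dotProduct_gram_ge lam k ω) _).trans
      (hG.entry_dotProduct_self_le k a b ω)
  unfold GameProcess.width
  gcongr

variable [IsProbabilityMeasure P]

lemma IsInteraction.integral_noise (hG : IsInteraction G P) (k : Fin K) (t : Fin T) :
    ∫ ω, G.noise k t ω ∂P = 0 := by
  rw [← integral_condExp (hG.infoActions_le k t), integral_congr_ae (hG.noise_mean k t)]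
  simp

/-- The expected regret of a single round. -/
lemma IsOFULinMat.integral_round_le {lam B N κ : ℝ} (hlam : 0 < lam) (hB : 0 ≤ B) (hN : 0 < N)
    (hS : 1 ≤ S) (hG : IsInteraction G P) (hO : IsOFULinMat G P lam B (1 / N))
    (hball : ParamInBall G P B) (hR : IsRegularGame G P lam κ) (k : Fin K) (t : Fin T) :
    Integrable (fun ω => gameValue (G.game k ω) - G.reward k t ω) P ∧
    Integrable (fun ω => G.width lam B (1 / N) k (G.feature k t ω) ω) P ∧
    ∫ ω, (gameValue (G.game k ω) - G.reward k t ω) ∂P ≤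
      ∫ ω, G.width lam B (1 / N) k (G.feature k t ω) ω ∂P + 1 / N := by
  obtain ⟨ω₀⟩ : Nonempty Ω := nonempty_of_isProbabilityMeasure P
  have : Nonempty (Fin n₁) := ⟨G.row k t ω₀⟩
  have : Nonempty (Fin n₂) := ⟨G.col k t ω₀⟩
  have hle := hG.info_le k t
  have hMm : ∀ a b, Measurable[G.info k t] fun ω => G.game k ω a b :=
    fun a b => G.measurable_info_game k t a b
  have hWm := fun a b => G.measurable_info_width lam B (1 / N) k t a b
  have hMi : ∀ a b, Integrable (fun ω => G.game k ω a b) P := fun a b =>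
    Integrable.of_bound ((hMm a b).mono hle le_rfl).aestronglyMeasurable (B * √S)
      (hball.mono fun ω hω => hG.abs_game_le hB hω k a b)
  have hWi : ∀ a b, Integrable (fun ω => G.width lam B (1 / N) k (G.entry k a b ω) ω) P :=
    fun a b => Integrable.of_bound ((hWm a b).mono hle le_rfl).aestronglyMeasurable _
      (ae_of_all _ fun ω => by
        rw [Real.norm_of_nonneg (G.width_nonneg _ _ _ _ _ _)]
        exact hG.width_le hlam hB hN hS k a b ω)
  have hact := (hG.measurable_row k t).prodMk (hG.measurable_col k t)
  have hWti : Integrable (fun ω => G.width lam B (1 / N) k (G.feature k t ω) ω) P := by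
    refine Integrable.of_bound (Measurable.aestronglyMeasurable ?_) _
      (ae_of_all _ fun ω => (Real.norm_of_nonneg (G.width_nonneg _ _ _ _ _ _)).trans_le
        (hG.width_le hlam hB hN hS k (G.row k t ω) (G.col k t ω) ω))
    exact measurable_apply_of_countable
      (f := fun (p : Fin n₁ × Fin n₂) ω => G.width lam B (1 / N) k (G.entry k p.1 p.2 ω) ω)
      (fun p => (hWm p.1 p.2).mono hle le_rfl) hact
  have hMti : Integrable (fun ω => G.game k ω (G.row k t ω) (G.col k t ω)) P := by
    refine Integrable.of_bound (Measurable.aestronglyMeasurable ?_) (B * √S)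
      (hball.mono fun ω hω => hG.abs_game_le hB hω k _ _)
    exact measurable_apply_of_countable
      (f := fun (p : Fin n₁ × Fin n₂) ω => G.game k ω p.1 p.2)
      (fun p => (hMm p.1 p.2).mono hle le_rfl) hact
  have hVi : Integrable (fun ω => gameValue (G.game k ω)) P :=
    Integrable.of_bound
      (measurable_gameValue fun a b => (hMm a b).mono hle le_rfl).aestronglyMeasurable (B * √S)
      (hball.mono fun ω hω => abs_gameValue_le fun a b => hG.abs_game_le hB hω k a b)
  have hri : Integrable (G.reward k t) P := hMti.add (hG.integrable_noise k t)
  have hfail : MeasurableSet (G.noiseFails lam (1 / N) k) :=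
    hG.measurableSet_confidence_fails lam k (1 / N)
  have hind : Integrable ((G.noiseFails lam (1 / N) k).indicator fun _ => (1 : ℝ)) P :=
    (integrable_const 1).indicator hfail
  -- The entry plus its width is known before the draw, so its average over mixed strategies is its
  -- mean at the actions drawn; there the width becomes that of `feature`.
  obtain ⟨hSi, hSe⟩ := hG.integral_comp_actions k t
    (h := fun a b ω => G.game k ω a b + G.width lam B (1 / N) k (G.entry k a b ω) ω)
    (fun a b => Measurable.fun_add (m := G.info k t) (hMm a b) (hWm a b))
    fun a b => (hMi a b).add (hWi a b)
  refine ⟨hVi.sub hri, hWti, ?_⟩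
  have hval := integral_mono_ae hVi (hSi.add hind)
    (hO.gameValue_le hlam hB hG hball hR k t)
  have hprob : ∫ ω, (G.noiseFails lam (1 / N) k).indicator (fun _ => (1 : ℝ)) ω ∂P ≤ 1 / N := by
    rw [integral_indicator_const _ hfail, smul_eq_mul, mul_one]
    exact ENNReal.toReal_le_of_le_ofReal (by positivity)
      (hG.measure_confidence_fails_le hlam k (by positivity))
  have hr : ∫ ω, G.reward k t ω ∂P = ∫ ω, G.game k ω (G.row k t ω) (G.col k t ω) ∂P := by
    have := integral_add hMti (hG.integrable_noise k t)
    rw [hG.integral_noise k t, add_zero] at this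
    exact this
  rw [integral_sub hVi hri, hr]
  have h1 := integral_add hSi hind
  have h2 := integral_add hMti hWti
  have h3 : ∫ ω, (G.game k ω (G.row k t ω) (G.col k t ω) +
      G.width lam B (1 / N) k (G.entry k (G.row k t ω) (G.col k t ω) ω) ω) ∂P =
    ∫ ω, G.game k ω (G.row k t ω) (G.col k t ω) ∂P +
      ∫ ω, G.width lam B (1 / N) k (G.feature k t ω) ω ∂P := h2
  have hval' : ∫ ω, gameValue (G.game k ω) ∂P ≤ _ := hval.trans_eq h1
  linarith

end Regret

/-! ### Summation and the explicit constant. -/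

/-- Summing the regret of all rounds. -/
lemma IsOFULinMat.saddlePointRegret_le {Ω : Type*} [MeasurableSpace Ω] {S K T n₁ n₂ : ℕ}
    {G : GameProcess Ω S K T n₁ n₂} {P : Measure Ω} [IsProbabilityMeasure P] {lam B κ : ℝ}
    (hlam : 0 < lam) (hB : 0 ≤ B) (hκ : 0 < κ) (hN : 0 < (K : ℝ) * T)
    (hS : 1 ≤ S) (hG : IsInteraction G P) (hO : IsOFULinMat G P lam B (1 / ((K : ℝ) * T)))
    (hball : ParamInBall G P B) (hR : IsRegularGame G P lam κ) :
    Integrable G.realizedRegret P ∧ G.saddlePointRegret P ≤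
      2 * (√(S * Real.log (S * (lam + K * T) / lam) + 2 * Real.log (K * T)) + √lam * B) *
        √((K * T) * (κ * (S * Real.log (S * (lam + K * T) / lam)))) + 1 := by
  have hround := fun k t => hO.integral_round_le hlam hB hN hS hG hball hR k t
  have hint : Integrable G.realizedRegret P :=
    integrable_finsetSum _ fun k _ => integrable_finsetSum _ fun t _ => (hround k t).1
  refine ⟨hint, ?_⟩
  have h1 : G.saddlePointRegret P =
      ∑ k, ∑ t, ∫ ω, (gameValue (G.game k ω) - G.reward k t ω) ∂P := by
    unfold GameProcess.saddlePointRegret GameProcess.realizedRegret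
    rw [integral_finsetSum _ fun k _ => integrable_finsetSum _ fun t _ => (hround k t).1]
    exact Finset.sum_congr rfl fun k _ => integral_finsetSum _ fun t _ => (hround k t).1
  have hWi : ∀ k : Fin K, Integrable (fun ω => ∑ t : Fin T,
      G.width lam B (1 / ((K : ℝ) * T)) k (G.feature k t ω) ω) P := fun k : Fin K =>
    integrable_finsetSum _ fun t _ => (hround k t).2.1
  have h2 : ∑ k : Fin K, ∑ t : Fin T,
      ∫ ω, G.width lam B (1 / ((K : ℝ) * T)) k (G.feature k t ω) ω ∂P =
      ∫ ω, ∑ k : Fin K, ∑ t : Fin T,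
        G.width lam B (1 / ((K : ℝ) * T)) k (G.feature k t ω) ω ∂P := by
    rw [integral_finsetSum _ fun k _ => hWi k]
    exact Finset.sum_congr rfl fun k _ =>
      (integral_finsetSum _ fun t _ => (hround k t).2.1).symm
  have h3 : ∑ _k : Fin K, ∑ _t : Fin T, (1 / ((K : ℝ) * T)) = 1 := by
    simp only [Finset.sum_const, Finset.card_univ, Fintype.card_fin, nsmul_eq_mul]
    rw [← mul_assoc, mul_one_div_cancel hN.ne']
  have h4 := integral_mono_ae (integrable_finsetSum _ fun k _ => hWi k) (integrable_const _)
    (hR.det_ratio.mono fun ω hω => G.sum_width_feature_le hlam hB hκ hN hS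
      (fun k t => hG.entry_dotProduct_self_le k (G.row k t ω) (G.col k t ω) ω) hω)
  rw [integral_const, probReal_univ, one_smul] at h4
  rw [h1]
  refine (Finset.sum_le_sum fun k _ => Finset.sum_le_sum fun t _ => (hround k t).2.2).trans ?_
  simp_rw [Finset.sum_add_distrib]
  rw [h3, h2]
  linarith

/-- As `N S ≥ 2`, the logarithm `l = log (N S)` is at least `log 2`; dividing by `log 2` or its root
therefore absorbs every additive constant into multiples of `l` or `√l`. -/
lemma regret_bound_le {lam B κ : ℝ} (hlam : 0 < lam) (hB : 0 < B) (hκ : 0 < κ) {S N : ℝ}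
    (hS : 1 ≤ S) (hN : 2 ≤ N) :
    2 * (√(S * Real.log (S * (lam + N) / lam) + 2 * Real.log N) + √lam * B) *
        √(N * (κ * (S * Real.log (S * (lam + N) / lam)))) + 1 ≤
      (2 * (√(1 + Real.log (1 + 1 / lam) / Real.log 2 + 2) + √lam * B / √(Real.log 2)) *
        √(κ * (1 + Real.log (1 + 1 / lam) / Real.log 2)) + 1 / Real.log 2) *
        (S * √N * Real.log (N * S)) := by
  have hl2 : 0 < Real.log 2 := Real.log_pos (by norm_num)
  have hN0 : 0 < N := by linarith
  have hS0 : 0 < S := by linarith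
  have hNS : 2 ≤ N * S := by nlinarith
  set l := Real.log (N * S) with hl
  have hl2l : Real.log 2 ≤ l := Real.log_le_log (by norm_num) hNS
  have hl0 : 0 < l := hl2.trans_le hl2l
  have ha0 : 0 ≤ Real.log (1 + 1 / lam) :=
    Real.log_nonneg (le_add_of_nonneg_right (by positivity))
  set c := 1 + Real.log (1 + 1 / lam) / Real.log 2 with hc
  have hc0 : 0 < c := by positivity
  have hlog : Real.log (S * (lam + N) / lam) ≤ c * l := by
    have h1 : S * (lam + N) / lam ≤ N * S * (1 + 1 / lam) := by
      have : N * S * (1 + 1 / lam) = S * (lam * N + N) / lam := by field_simp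
      rw [this]
      gcongr
      nlinarith
    refine (Real.log_le_log (by positivity) h1).trans ?_
    rw [Real.log_mul (by positivity) (by positivity), hc, add_mul, one_mul, div_mul_eq_mul_div,
      ← hl]
    gcongr
    rw [le_div_iff₀ hl2]
    gcongr
  have hlogN : Real.log N ≤ l := Real.log_le_log hN0 (by nlinarith)
  have hSl : l ≤ S * l := by nlinarith
  -- Both square roots are of order `q`, and `q * q = S * l` gives the linear dependence on `S` and
  -- on the logarithm.
  set q := √(S * l) with hq
  have hqq : q * q = S * l := Real.mul_self_sqrt (by positivity)
  have h1 : √(S * Real.log (S * (lam + N) / lam) + 2 * Real.log N) ≤ √(c + 2) * q := by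
    rw [hq, ← Real.sqrt_mul (by positivity)]
    apply Real.sqrt_le_sqrt
    nlinarith [mul_le_mul_of_nonneg_left hlog hS0.le]
  have h2 : √lam * B ≤ √lam * B / √(Real.log 2) * q := by
    rw [div_mul_eq_mul_div, le_div_iff₀ (Real.sqrt_pos.2 hl2)]
    gcongr
    exact Real.sqrt_le_sqrt (hl2l.trans hSl)
  have h3 : √(N * (κ * (S * Real.log (S * (lam + N) / lam)))) ≤ √N * (√(κ * c) * q) := by
    rw [hq, ← Real.sqrt_mul (by positivity), ← Real.sqrt_mul (by positivity)]
    apply Real.sqrt_le_sqrt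
    have : κ * c * (S * l) = κ * (S * (c * l)) := by ring
    rw [this]
    gcongr
  have h4 : 1 ≤ 1 / Real.log 2 * (S * √N * l) := by
    rw [div_mul_eq_mul_div, one_mul, le_div_iff₀ hl2, one_mul]
    have : 1 ≤ √N := Real.one_le_sqrt.2 (by linarith)
    nlinarith [mul_le_mul hS this zero_le_one hS0.le]
  calc _ ≤ 2 * (√(c + 2) * q + √lam * B / √(Real.log 2) * q) * (√N * (√(κ * c) * q)) +
        1 / Real.log 2 * (S * √N * l) := by gcongr
    _ = 2 * (√(c + 2) + √lam * B / √(Real.log 2)) * √(κ * c) * √N * (q * q) +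
        1 / Real.log 2 * (S * √N * l) := by ring
    _ = _ := by rw [hqq]; ring

end

theorem corollary1 (lam B κ : ℝ) (hlam : 0 < lam) (hB : 0 < B) (hκ : 1 < κ) :
    ∃ C : ℝ, 0 < C ∧
      ∀ (S K T n₁ n₂ : ℕ), 1 ≤ S → 2 ≤ K * T →
      ∀ (Ω : Type u) [MeasurableSpace Ω] (P : Measure Ω) [IsProbabilityMeasure P]
        (G : GameProcess Ω S K T n₁ n₂),
        IsInteraction G P →
        IsOFULinMat G P lam B (1 / ((K : ℝ) * (T : ℝ))) →
        ParamInBall G P B →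
        IsRegularGame G P lam κ →
        Integrable G.realizedRegret P ∧
        G.saddlePointRegret P ≤
          C * ((S : ℝ) * √((K : ℝ) * (T : ℝ)) *
            Real.log ((K : ℝ) * (T : ℝ) * (S : ℝ))) := by
  have hκ0 : 0 < κ := by linarith
  have hl2 : 0 < Real.log 2 := Real.log_pos (by norm_num)
  refine ⟨2 * (√(1 + Real.log (1 + 1 / lam) / Real.log 2 + 2) + √lam * B / √(Real.log 2)) *
        √(κ * (1 + Real.log (1 + 1 / lam) / Real.log 2)) + 1 / Real.log 2, by positivity, ?_⟩
  intro S K T n₁ n₂ hS hKT Ω _ P _ G hG hO hball hR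
  have hN : (2 : ℝ) ≤ (K : ℝ) * T := by exact_mod_cast hKT
  obtain ⟨hint, hle⟩ := hO.saddlePointRegret_le hlam hB.le hκ0 (by linarith) hS hG hball hR
  exact ⟨hint, hle.trans (regret_bound_le hlam hB hκ0 (by exact_mod_cast hS) hN)⟩
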